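/- Let $K$ be an infinite field, $n\ge 0$, and let $S=K[x_1,\dots,x_n]$ be the standard graded polynomial ring. Let $M$ be a finitely generated ($\mathbb Z$-)graded $S$-module, with graded Betti numbers $\beta^S_{i,j}(M)=\dim_K \operatorname{Tor}^S_i(K,M)_j$. For a sequence $y_1,\dots,y_n$ of linear forms of $S$ and $1\le p\le n$, let $$A_p=\bigl((y_1,\dots,y_{p-1})M:_M y_p\bigr)/(y_1,\dots,y_{p-1})M .$$ For $k\in\mathbb Z$ the generic graded annihilator number $\alpha_{p,k}(M)$ is the value of $\dim_K (A_p)_k$ for a generic sequence $y_1,\dots,y_n$, i.e. the constant value which it takes for all $(y_1,\dots,y_n)$ whose coefficient matrix lies in some nonempty Zariski open subset of $K^{n\times n}$. Suppose that for some integers $i>1$ and $k$ we have $$\beta^S_{i,i+k}(M)=\sum_{j=1}^{n-i+1}\binom{n-j}{i-1}\alpha_{j,k}(M).$$ Then $$\beta^S_{q,q+k}(M)=\sum_{j=1}^{n-q+1}\binom{n-j}{q-1}\alpha_{j,k}(M)\qquad\text{for all } q\ge i .$$ (A sum whose upper limit is smaller than $1$ is $0$.) -/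

import Mathlib

open scoped TensorProduct

noncomputable section

namespace GradedBetti

universe u v w

section Basic

variable {K : Type u} [Field K] {n : ℕ}

/-- A `ℤ`-grading `𝓜` of a module `M` over the standard graded polynomial ring
`S = K[x_1, …, x_n]`: `M` is the direct sum of the `K`-subspaces `𝓜 j`, and
`S_d • 𝓜 j ⊆ 𝓜 (j + d)`. -/
class IsGradedModule {M : Type v} [AddCommGroup M] [Module K M]
    [Module (MvPolynomial (Fin n) K) M] (𝓜 : ℤ → Submodule K M) : Prop where
  isInternal : DirectSum.IsInternal 𝓜
  smul_mem : ∀ (d : ℕ) (j : ℤ) (f : MvPolynomial (Fin n) K) (m : M),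
    f ∈ MvPolynomial.homogeneousSubmodule (Fin n) K d → m ∈ 𝓜 j → f • m ∈ 𝓜 (j + d)

/-- The degree `j` component of the graded free module `⨁_e S(-deg e)`, whose basis element
indexed by `e` is homogeneous of degree `deg e`. -/
def freePart {ι : Type w} (deg : ι → ℤ) (j : ℤ) :
    Submodule K (ι →₀ MvPolynomial (Fin n) K) where
  carrier := {f | ∀ e c, MvPolynomial.coeff c (f e) ≠ 0 → (c.degree : ℤ) + deg e = j}
  zero_mem' := by
    intro e c h
    simp at h
  add_mem' := by
    intro f g hf hg e c h
    by_cases h1 : MvPolynomial.coeff c (f e) = 0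
    · refine hg e c fun h2 => h ?_
      simp [h1, h2]
    · exact hf e c h1
  smul_mem' := by
    intro a f hf e c h
    refine hf e c fun h1 => h ?_
    simp [h1]

/-- The field `K` regarded as an `S`-module: each `x_i` acts as zero. -/
def ResidueModule (K : Type u) (_ : ℕ) : Type u := K

instance : AddCommGroup (ResidueModule K n) := inferInstanceAs (AddCommGroup K)

instance : Module K (ResidueModule K n) := inferInstanceAs (Module K K)

instance : Module (MvPolynomial (Fin n) K) (ResidueModule K n) :=
  Module.compHom K (MvPolynomial.constantCoeff (σ := Fin n) (R := K))

theorem ResidueModule.smul_def (f : MvPolynomial (Fin n) K) (a : ResidueModule K n) :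
    f • a = (MvPolynomial.constantCoeff f • a : ResidueModule K n) := rfl

instance : SMulCommClass (MvPolynomial (Fin n) K) K (ResidueModule K n) where
  smul_comm f a b := by
    rw [ResidueModule.smul_def, ResidueModule.smul_def]
    exact smul_comm _ _ _

instance : IsScalarTower K (MvPolynomial (Fin n) K) (ResidueModule K n) where
  smul_assoc a f b := by
    rw [ResidueModule.smul_def, ResidueModule.smul_def, MvPolynomial.constantCoeff_smul]
    exact smul_assoc _ _ _

/-- The element `1` of the `S`-module `K`. -/
def ResidueModule.one (K : Type u) [Field K] (n : ℕ) : ResidueModule K n := (1 : K)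

/-- The degree `j` component of `K ⊗_S F`, where `K` sits in degree `0` and
`F = ⨁_e S(-deg e)`. -/
def tensorPart {ι : Type w} (deg : ι → ℤ) (j : ℤ) :
    Submodule K (ResidueModule K n ⊗[MvPolynomial (Fin n) K]
      (ι →₀ MvPolynomial (Fin n) K)) :=
  (freePart deg j).map
    ((TensorProduct.mk (MvPolynomial (Fin n) K) (ResidueModule K n)
      (ι →₀ MvPolynomial (Fin n) K) (ResidueModule.one K n)).restrictScalars K)

end Basic

section Resolution

variable {K : Type u} [Field K] {n : ℕ} {M : Type v} [AddCommGroup M] [Module K M]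
  [Module (MvPolynomial (Fin n) K) M]

/-- A graded free resolution `⋯ → F_1 → F_0 → M → 0` of the graded `S`-module `(M, 𝓜)`, with
`F_i = ⨁_{e ∈ ι i} S(-deg e)` and all maps homogeneous of degree zero. -/
structure GradedFreeResolution (𝓜 : ℤ → Submodule K M) where
  ι : ℕ → Type (max u v)
  deg : ∀ i, ι i → ℤ
  aug : (ι 0 →₀ MvPolynomial (Fin n) K) →ₗ[MvPolynomial (Fin n) K] M
  d : ∀ i, (ι (i + 1) →₀ MvPolynomial (Fin n) K) →ₗ[MvPolynomial (Fin n) K]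
    (ι i →₀ MvPolynomial (Fin n) K)
  aug_mem : ∀ j, ∀ x ∈ freePart (deg 0) j, aug x ∈ 𝓜 j
  d_mem : ∀ i j, ∀ x ∈ freePart (deg (i + 1)) j, d i x ∈ freePart (K := K) (deg i) j
  aug_surjective : Function.Surjective aug
  exact_zero : Function.Exact (d 0) aug
  exact_succ : ∀ i, Function.Exact (d (i + 1)) (d i)

namespace GradedFreeResolution

variable {𝓜 : ℤ → Submodule K M}

/-- The differential `K ⊗_S F_{i+1} → K ⊗_S F_i`. -/
def tensorD (F : GradedFreeResolution (n := n) 𝓜) (i : ℕ) :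
    (ResidueModule K n ⊗[MvPolynomial (Fin n) K]
      (F.ι (i + 1) →₀ MvPolynomial (Fin n) K)) →ₗ[K]
    (ResidueModule K n ⊗[MvPolynomial (Fin n) K]
      (F.ι i →₀ MvPolynomial (Fin n) K)) :=
  ((F.d i).lTensor (ResidueModule K n)).restrictScalars K

/-- The cycles of degree `j` in `K ⊗_S F_i`. -/
def cycles (F : GradedFreeResolution (n := n) 𝓜) : (i : ℕ) → (j : ℤ) →
    Submodule K (ResidueModule K n ⊗[MvPolynomial (Fin n) K]
      (F.ι i →₀ MvPolynomial (Fin n) K))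
  | 0, j => tensorPart (F.deg 0) j
  | i + 1, j => tensorPart (F.deg (i + 1)) j ⊓ LinearMap.ker (F.tensorD i)

/-- The boundaries of degree `j` in `K ⊗_S F_i`. -/
def boundaries (F : GradedFreeResolution (n := n) 𝓜) (i : ℕ) (j : ℤ) :
    Submodule K (ResidueModule K n ⊗[MvPolynomial (Fin n) K]
      (F.ι i →₀ MvPolynomial (Fin n) K)) :=
  (tensorPart (F.deg (i + 1)) j).map (F.tensorD i)

/-- `dim_K Tor_i^S(K, M)_j`, where `Tor_i^S(K, M)_j = H_i(K ⊗_S F)_j`. -/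
def torDim (F : GradedFreeResolution (n := n) 𝓜) (i : ℕ) (j : ℤ) : ℕ :=
  Module.finrank K (F.cycles i j ⧸ (F.boundaries i j).submoduleOf (F.cycles i j))

end GradedFreeResolution

end Resolution

section Existence

variable {K : Type u} [Field K] {n : ℕ}

theorem freePart_iSupIndep {ι : Type w} (deg : ι → ℤ) :
    iSupIndep (freePart (K := K) (n := n) deg) := by
  rw [iSupIndep_iff_finsetSum_eq_zero_imp_eq_zero]
  intro s v hv hs j hj
  ext e c
  by_contra hne
  have h0 : ∑ j' ∈ s, MvPolynomial.coeff c (v j' e) = 0 := by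
    have := congrArg (fun f : ι →₀ MvPolynomial (Fin n) K => MvPolynomial.coeff c (f e)) hs
    simpa [Finsupp.finsetSum_apply, MvPolynomial.coeff_sum] using this
  rw [Finset.sum_eq_single_of_mem j hj] at h0
  · exact hne (by simpa using h0)
  · intro j' hj' hjj
    by_contra h
    exact hjj ((hv j' hj' e c h).symm.trans (hv j hj e c (by simpa using hne)))

theorem freePart_single_monomial {ι : Type w} (deg : ι → ℤ) (e : ι) (c : Fin n →₀ ℕ) (a : K) :
    Finsupp.single e (MvPolynomial.monomial c a) ∈ freePart deg ((c.degree : ℤ) + deg e) := by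
  classical
  intro e' c' h
  rw [Finsupp.single_apply] at h
  split_ifs at h with he
  · rw [MvPolynomial.coeff_monomial] at h
    split_ifs at h with hc
    · rw [he, hc]
    · exact absurd rfl h
  · simp at h

theorem freePart_iSup {ι : Type w} (deg : ι → ℤ) :
    ⨆ j, freePart (K := K) (n := n) deg j = ⊤ := by
  rw [eq_top_iff]
  intro f _
  induction f using Finsupp.induction_linear with
  | zero => exact zero_mem _
  | add f g hf hg => exact add_mem (hf trivial) (hg trivial)
  | single e p =>
    induction p using MvPolynomial.induction_on' with
    | monomial c a =>
      exact Submodule.mem_iSup_of_mem _ (freePart_single_monomial deg e c a)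
    | add p q hp hq =>
      rw [Finsupp.single_add]
      exact add_mem (hp trivial) (hq trivial)

variable {N : Type w} [AddCommGroup N] [Module K N] [Module (MvPolynomial (Fin n) K) N]

theorem homogeneous_mem_ker {ι : Type v} (deg : ι → ℤ) (𝓝 : ℤ → Submodule K N)
    (h𝓝 : iSupIndep 𝓝)
    (φ : (ι →₀ MvPolynomial (Fin n) K) →ₗ[MvPolynomial (Fin n) K] N)
    (hφ : ∀ j, ∀ x ∈ freePart deg j, φ x ∈ 𝓝 j) :
    ∀ x ∈ LinearMap.ker φ, ∃ f : ℤ →₀ (ι →₀ MvPolynomial (Fin n) K),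
      (∀ j, f j ∈ freePart deg j ∧ f j ∈ LinearMap.ker φ) ∧ (f.sum fun _ y => y) = x := by
  intro x hx
  have hx' : x ∈ ⨆ j, freePart (K := K) (n := n) deg j := by
    rw [freePart_iSup]; trivial
  rw [Submodule.mem_iSup_iff_exists_finsupp] at hx'
  obtain ⟨f, hf, rfl⟩ := hx'
  refine ⟨f, fun j => ⟨hf j, ?_⟩, rfl⟩
  rw [LinearMap.mem_ker, Finsupp.sum, map_sum] at hx
  by_cases hj : j ∈ f.support
  · exact (iSupIndep_iff_finsetSum_eq_zero_imp_eq_zero 𝓝).1 h𝓝 f.support (fun j => φ (f j))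
      (fun j _ => hφ j _ (hf j)) hx j hj
  · rw [Finsupp.notMem_support_iff.1 hj]
    exact zero_mem _

/-- The graded free module on all elements of a family `𝓝` of subspaces, mapped to the module;
the basis element given by an element of `𝓝 j` has degree `j`. -/
def coverMap (𝓝 : ℤ → Submodule K N) :
    ((Σ j, ULift.{max u v} (𝓝 j)) →₀ MvPolynomial (Fin n) K) →ₗ[MvPolynomial (Fin n) K] N :=
  Finsupp.linearCombination _ fun z => (z.2.down : N)

theorem mem_range_coverMap (𝓝 : ℤ → Submodule K N) {j : ℤ} {x : N} (hx : x ∈ 𝓝 j) :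
    x ∈ LinearMap.range (coverMap.{u, v, w} (n := n) 𝓝) :=
  ⟨Finsupp.single ⟨j, ⟨⟨x, hx⟩⟩⟩ 1, by simp [coverMap]⟩

theorem coverMap_surjective (𝓝 : ℤ → Submodule K N) (h : ⨆ j, 𝓝 j = ⊤) :
    Function.Surjective (coverMap.{u, v, w} (n := n) 𝓝) := by
  rw [← LinearMap.range_eq_top, eq_top_iff]
  intro x _
  have hx : x ∈ ⨆ j, 𝓝 j := by
    rw [h]
    trivial
  rw [Submodule.mem_iSup_iff_exists_finsupp] at hx
  obtain ⟨f, hf, rfl⟩ := hx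
  exact Submodule.sum_mem _ fun j _ => mem_range_coverMap 𝓝 (hf j)

theorem coverMap_mem (𝓝 𝓝' : ℤ → Submodule K N)
    (h : ∀ (c : Fin n →₀ ℕ) (a : K) (j : ℤ), ∀ x ∈ 𝓝 j,
      MvPolynomial.monomial c a • x ∈ 𝓝' ((c.degree : ℤ) + j))
    (j : ℤ) (x : (Σ j, ULift.{max u v} (𝓝 j)) →₀ MvPolynomial (Fin n) K)
    (hx : x ∈ freePart (fun z => z.1) j) : coverMap.{u, v, w} 𝓝 x ∈ 𝓝' j := by
  rw [coverMap, Finsupp.linearCombination_apply, Finsupp.sum]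
  refine Submodule.sum_mem _ fun e _ => ?_
  rw [MvPolynomial.as_sum (x e), Finset.sum_smul]
  refine Submodule.sum_mem _ fun c hc => ?_
  have := h c (MvPolynomial.coeff c (x e)) e.1 _ e.2.down.2
  rwa [hx e c (MvPolynomial.mem_support_iff.1 hc)] at this

theorem coverMap_mem_of_le (𝓝 : ℤ → Submodule K N) (Z : Submodule (MvPolynomial (Fin n) K) N)
    (h : ∀ j, ∀ x ∈ 𝓝 j, x ∈ Z)
    (x : (Σ j, ULift.{max u v} (𝓝 j)) →₀ MvPolynomial (Fin n) K) :
    coverMap.{u, v, w} 𝓝 x ∈ Z := by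
  rw [coverMap, Finsupp.linearCombination_apply, Finsupp.sum]
  exact Submodule.sum_mem _ fun e _ => Submodule.smul_mem _ _ (h _ _ e.2.down.2)

theorem freePart_monomial_smul {ι : Type w} (deg : ι → ℤ) (c : Fin n →₀ ℕ) (a : K) (j : ℤ)
    (x : ι →₀ MvPolynomial (Fin n) K) (hx : x ∈ freePart deg j) :
    MvPolynomial.monomial c a • x ∈ freePart deg ((c.degree : ℤ) + j) := by
  intro e c' h
  rw [Finsupp.smul_apply, smul_eq_mul, MvPolynomial.coeff_monomial_mul'] at h
  split_ifs at h with hc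
  · have h1 := hx e (c' - c) (right_ne_zero_of_mul h)
    have h2 : c'.degree = c.degree + (c' - c).degree := by
      rw [← map_add, add_tsub_cancel_of_le hc]
    rw [h2]
    push_cast
    linarith
  · exact absurd rfl h

/-- One stage in the construction of a graded free resolution: a graded free module with a
submodule of relations still to be covered. -/
structure Stage (K : Type u) [Field K] (n : ℕ) where
  ι : Type w
  deg : ι → ℤ
  rel : Submodule (MvPolynomial (Fin n) K) (ι →₀ MvPolynomial (Fin n) K)

/-- The homogeneous relations of degree `j`. -/
def Stage.relPart (s : Stage.{u, w} K n) (j : ℤ) :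
    Submodule K (s.ι →₀ MvPolynomial (Fin n) K) :=
  freePart s.deg j ⊓ s.rel.restrictScalars K

/-- The stage whose relations are the kernel of `coverMap`. -/
def coverStage (𝓝 : ℤ → Submodule K N) : Stage.{u, max u v w} K n where
  ι := Σ j, ULift.{max u v} (𝓝 j)
  deg := fun z => z.1
  rel := LinearMap.ker (coverMap.{u, v, w} (n := n) 𝓝)

end Existence

section Existence'

variable {K : Type u} [Field K] {n : ℕ} {M : Type v} [AddCommGroup M] [Module K M]
  [Module (MvPolynomial (Fin n) K) M]

/-- The stages of the construction of a graded free resolution of `M`. -/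
def stages (𝓜 : ℤ → Submodule K M) : ℕ → Stage.{u, max u v} K n
  | 0 => coverStage.{u, v, v} 𝓜
  | i + 1 => coverStage.{u, v, max u v} (stages 𝓜 i).relPart

/-- The differentials of the graded free resolution of `M` under construction. -/
def stagesD (𝓜 : ℤ → Submodule K M) (i : ℕ) :
    ((stages (n := n) 𝓜 (i + 1)).ι →₀ MvPolynomial (Fin n) K) →ₗ[MvPolynomial (Fin n) K]
      ((stages (n := n) 𝓜 i).ι →₀ MvPolynomial (Fin n) K) :=
  coverMap.{u, v, max u v} (stages 𝓜 i).relPart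

theorem stagesD_mem (𝓜 : ℤ → Submodule K M) (i : ℕ) (j : ℤ)
    (x : (stages (n := n) 𝓜 (i + 1)).ι →₀ MvPolynomial (Fin n) K)
    (hx : x ∈ freePart (stages 𝓜 (i + 1)).deg j) :
    stagesD 𝓜 i x ∈ freePart (K := K) (stages 𝓜 i).deg j :=
  coverMap_mem (stages 𝓜 i).relPart (freePart (stages 𝓜 i).deg)
    (fun c a j y hy => freePart_monomial_smul _ c a j y hy.1) j x hx

theorem range_stagesD (𝓜 : ℤ → Submodule K M) (i : ℕ)
    (h : ∀ x ∈ (stages (n := n) 𝓜 i).rel,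
      ∃ f : ℤ →₀ ((stages (n := n) 𝓜 i).ι →₀ MvPolynomial (Fin n) K),
        (∀ j, f j ∈ freePart (stages 𝓜 i).deg j ∧ f j ∈ (stages 𝓜 i).rel) ∧
          (f.sum fun _ y => y) = x) :
    LinearMap.range (stagesD (n := n) 𝓜 i) = (stages 𝓜 i).rel := by
  apply le_antisymm
  · rintro _ ⟨x, rfl⟩
    exact coverMap_mem_of_le (stages 𝓜 i).relPart (stages 𝓜 i).rel (fun _ _ hy => hy.2) x
  · intro x hx
    obtain ⟨f, hf, rfl⟩ := h x hx
    exact Submodule.sum_mem _ fun j _ => mem_range_coverMap (stages 𝓜 i).relPart (hf j)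

/-- Every graded `S`-module has a graded free resolution. -/
theorem nonempty_gradedFreeResolution (𝓜 : ℤ → Submodule K M) [IsGradedModule (n := n) 𝓜] :
    Nonempty (GradedFreeResolution (n := n) 𝓜) := by
  have haug : ∀ j, ∀ x ∈ freePart (stages (n := n) 𝓜 0).deg j,
      coverMap.{u, v, v} (n := n) 𝓜 x ∈ 𝓜 j := by
    refine coverMap_mem (n := n) 𝓜 𝓜 fun c a j x hx => ?_
    rw [add_comm]
    exact IsGradedModule.smul_mem _ _ _ _
      (MvPolynomial.isHomogeneous_monomial a rfl) hx
  have hex : ∀ i, LinearMap.range (stagesD (n := n) 𝓜 i) = (stages 𝓜 i).rel := by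
    intro i
    apply range_stagesD
    cases i with
    | zero =>
      exact homogeneous_mem_ker _ 𝓜
        (IsGradedModule.isInternal (n := n) (𝓜 := 𝓜)).submodule_iSupIndep _ haug
    | succ i =>
      exact homogeneous_mem_ker _ (freePart (stages 𝓜 i).deg) (freePart_iSupIndep _)
        (stagesD 𝓜 i) (stagesD_mem 𝓜 i)
  exact ⟨{
    ι := fun i => (stages (n := n) 𝓜 i).ι
    deg := fun i => (stages 𝓜 i).deg
    aug := coverMap.{u, v, v} 𝓜
    d := stagesD 𝓜
    aug_mem := haug
    d_mem := stagesD_mem 𝓜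
    aug_surjective := coverMap_surjective 𝓜
      (IsGradedModule.isInternal (n := n) (𝓜 := 𝓜)).submodule_iSup_eq_top
    exact_zero := LinearMap.exact_iff.2 (hex 0).symm
    exact_succ := fun i => LinearMap.exact_iff.2 (hex (i + 1)).symm }⟩

end Existence'

section Numbers

variable {K : Type u} [Field K] {n : ℕ} {M : Type v} [AddCommGroup M] [Module K M]
  [Module (MvPolynomial (Fin n) K) M]

/-- The graded Betti number `β^S_{i,j}(M) = dim_K Tor_i^S(K, M)_j`, computed from a graded free
resolution of `M`. -/
def gradedBetti (𝓜 : ℤ → Submodule K M) [IsGradedModule (n := n) 𝓜] (i : ℕ) (j : ℤ) : ℕ :=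
  (Classical.choice (nonempty_gradedFreeResolution (n := n) 𝓜)).torDim i j

/-- The linear form `y_{p+1} = ∑_l c (p, l) x_{l+1}` (indices in `Fin n` start at `0`). -/
def linearForm (c : Fin n × Fin n → K) (p : Fin n) : MvPolynomial (Fin n) K :=
  ∑ l, c (p, l) • MvPolynomial.X l

/-- The submodule `(y_1, …, y_p) M`, for `p : Fin n`, of the forms `y_1, …, y_n` preceding
`linearForm c p = y_{p+1}`. -/
def precedingSubmodule (M : Type v) [AddCommGroup M] [Module (MvPolynomial (Fin n) K) M]
    (c : Fin n × Fin n → K) (p : Fin n) : Submodule (MvPolynomial (Fin n) K) M :=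
  Ideal.span (linearForm c '' {q | q < p}) • ⊤

/-- The `S`-module `((y_1, …, y_p) M :_M y_{p+1}) / (y_1, …, y_p) M`, as a submodule of
`M / (y_1, …, y_p) M`; this is `A_{p+1}` for the sequence `y_1, …, y_n`. -/
def annihilatorModule (M : Type v) [AddCommGroup M] [Module (MvPolynomial (Fin n) K) M]
    (c : Fin n × Fin n → K) (p : Fin n) :
    Submodule (MvPolynomial (Fin n) K) (M ⧸ precedingSubmodule M c p) :=
  ((precedingSubmodule M c p).comap
    (LinearMap.lsmul (MvPolynomial (Fin n) K) M (linearForm c p))).map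
      (precedingSubmodule M c p).mkQ

variable [IsScalarTower K (MvPolynomial (Fin n) K) M]

/-- The dimension of the degree `k` component of `annihilatorModule M c p`. -/
def annihilatorDim (𝓜 : ℤ → Submodule K M) (c : Fin n × Fin n → K) (p : Fin n) (k : ℤ) : ℕ :=
  Module.finrank K ↥((annihilatorModule M c p).restrictScalars K ⊓
    (𝓜 k).map ((precedingSubmodule M c p).mkQ.restrictScalars K))

/-- The number `a` is the value of `annihilatorDim 𝓜 c p k` for generic linear forms: it is
attained for all coefficients `c` in some nonempty Zariski open set (a principal one, which is
no restriction). -/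
def IsGenericAnnihilatorDim (𝓜 : ℤ → Submodule K M) (p : Fin n) (k : ℤ) (a : ℕ) : Prop :=
  ∃ F : MvPolynomial (Fin n × Fin n) K, F ≠ 0 ∧
    ∀ c : Fin n × Fin n → K, MvPolynomial.eval c F ≠ 0 → annihilatorDim 𝓜 c p k = a

/-- The generic graded annihilator number `α_{p+1,k}(M)`: the value of `annihilatorDim 𝓜 c p k`
for generic linear forms (`K` infinite, `M` finitely generated), that is, the only element of the
set below. -/
def genericAnnihilatorNumber (n : ℕ) {M : Type v} [AddCommGroup M] [Module K M]
    [Module (MvPolynomial (Fin n) K) M] [IsScalarTower K (MvPolynomial (Fin n) K) M]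
    (𝓜 : ℤ → Submodule K M) (p : Fin n) (k : ℤ) : ℕ :=
  sSup {a | IsGenericAnnihilatorDim 𝓜 p k a}

/-- The upper bound `∑_{j=1}^{n-i+1} C(n-j, i-1) α_{j,k}(M)` for `β^S_{i,i+k}(M)`; the summation
index `j` of this formula is `p + 1` with `p : Fin n`. -/
def bettiBound (n : ℕ) {M : Type v} [AddCommGroup M] [Module K M]
    [Module (MvPolynomial (Fin n) K) M] [IsScalarTower K (MvPolynomial (Fin n) K) M]
    (𝓜 : ℤ → Submodule K M) (i : ℕ) (k : ℤ) : ℕ :=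
  ∑ p ∈ Finset.univ.filter (fun p : Fin n => (p : ℕ) + 1 ≤ n + 1 - i),
    (n - ((p : ℕ) + 1)).choose (i - 1) * genericAnnihilatorNumber n 𝓜 p k

end Numbers

end GradedBetti

end

/-!
The graded Betti numbers of `M` in homological degrees `> 1` are the dimensions of the Koszul
homology of `M` with respect to any coordinates `y_1, …, y_n` of `S`
(`GradedFreeResolution.torDim_eq_quotDim`), here by dimension shifting along a graded free
resolution, the Koszul complex of a free module being acyclic. Fix `k` and write `H_a(W)` for the
part of degree `a + k` of the `a`-th Koszul homology of `M` with respect to the `y_s`, `s ∈ W`.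

*The bound.* For `r ∉ W` the long exact sequence of Koszul homology gives
`dim H_{a+1}(W ∪ r) ≤ dim H_{a+1}(W) + dim H_a(W)` for `a > 0`, with equality if and only if `y_r`
multiplies the cycles of degrees `a + 1` and `a` on `W`, with coefficients in `M_{k-1}` and in `M_k`
respectively, into boundaries; for `a = 0` an annihilator number takes the place of `dim H_0(W)`
(`quotDim_insert`). Summing this up with Pascal's rule bounds `dim H_a(W)` by a sum of annihilator
numbers (`quotDim_le_annihilatorSum`). The coordinates are chosen so that every ordering of
`y_1, …, y_n` realizes the generic annihilator numbers (`exists_generic_coordinates`). Hence the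
bound holds for all index sets `W`, depends only on `|W|`, and equality for the full index set in
degree `a > 1` descends to all `W`; so multiplication by `y_r` vanishes on the homology of every `W`
not containing `r`, in degree `a - 1` on the strand `k` and in degree `a` on the strand `k - 1`.

*Rigidity.* Such vanishing propagates from degree `a` to degree `a + 1` (`smul_mem_bnd_succ`). If
`z` is a cycle of degree `a + 1` on `W`, then all contractions of `y_r z` with dual basis vectors
are boundaries on smaller index sets, and an element with this property is itself a boundary
(`mem_bnd_of_contr_mem_bnd`): the contractions of the primitives of two contractions differ, up to
sign, by a cycle of degree `a`, which becomes a boundary after multiplication by one of the forms.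
So all the inequalities for degree `a + 1` are equalities as well (`quotDim_univ_succ_eq`).
-/

open scoped TensorProduct

noncomputable section

namespace GradedBetti

/-! ### The Koszul differential, contractions and exterior multiplication -/

section Operators

variable {R ι M : Type*} [CommRing R] [LinearOrder ι] [AddCommGroup M] [Module R M]

/-- The sign `(-1)^{#{t ∈ T | t < s}}` by which, for `s ∉ T`, the product `e_s ∧ e_T` differs from
the basis vector `e_{T ∪ {s}}`, whose factors are in increasing order. -/
def koszulSign (s : ι) (T : Finset ι) : ℤ := (-1) ^ (T.filter (· < s)).card

theorem koszulSign_mul_self (s : ι) (T : Finset ι) : koszulSign s T * koszulSign s T = 1 := by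
  rw [koszulSign, ← mul_pow]
  simp

theorem koszulSign_insert_self (s : ι) (T : Finset ι) :
    koszulSign s (insert s T) = koszulSign s T := by
  simp [koszulSign, Finset.filter_insert]

theorem koszulSign_erase_self (s : ι) (T : Finset ι) :
    koszulSign s (T.erase s) = koszulSign s T := by
  rw [koszulSign, koszulSign, Finset.filter_erase, Finset.erase_eq_of_notMem (by simp)]

theorem koszulSign_insert {s t : ι} {T : Finset ι} (ht : t ∉ T) :
    koszulSign s (insert t T) = if t < s then - koszulSign s T else koszulSign s T := by
  rw [koszulSign, koszulSign, Finset.filter_insert]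
  split_ifs with h
  · rw [Finset.card_insert_of_notMem (by simp [ht]), pow_succ]
    ring
  · rfl

theorem koszulSign_mul_insert {s t : ι} (hst : s ≠ t) {T : Finset ι} (hs : s ∉ T) (ht : t ∉ T) :
    koszulSign s T * koszulSign t (insert s T) =
      -(koszulSign t T * koszulSign s (insert t T)) := by
  rw [koszulSign_insert hs, koszulSign_insert ht]
  rcases lt_or_gt_of_ne hst with h | h
  · rw [if_pos h, if_neg h.not_gt]
    ring
  · rw [if_neg h.not_gt, if_pos h]
    ring

variable (R) in
/-- Contraction of `M ⊗ ⋀ R^ι` with the dual basis vector of index `s`. An element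
`∑_T f_T e_T` of `M ⊗ ⋀ R^ι` is encoded as the function `T ↦ f_T`. -/
def contr (s : ι) : (Finset ι → M) →ₗ[R] (Finset ι → M) where
  toFun f T := if s ∈ T then 0 else koszulSign s T • f (insert s T)
  map_add' f g := by
    ext T
    by_cases h : s ∈ T <;> simp [h]
  map_smul' r f := by
    ext T
    by_cases h : s ∈ T
    · simp [h]
    · simp only [h, if_false, Pi.smul_apply, RingHom.id_apply]
      exact smul_comm _ _ _

variable (R) in
/-- Left multiplication of `M ⊗ ⋀ R^ι` by the basis vector `e_s`. -/
def wedge (s : ι) : (Finset ι → M) →ₗ[R] (Finset ι → M) where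
  toFun f T := if s ∈ T then koszulSign s T • f (T.erase s) else 0
  map_add' f g := by
    ext T
    by_cases h : s ∈ T <;> simp [h]
  map_smul' r f := by
    ext T
    by_cases h : s ∈ T
    · simp only [h, if_true, Pi.smul_apply, RingHom.id_apply]
      exact smul_comm _ _ _
    · simp [h]

theorem contr_apply (s : ι) (f : Finset ι → M) (T : Finset ι) :
    contr R s f T = if s ∈ T then 0 else koszulSign s T • f (insert s T) := rfl

theorem wedge_apply (s : ι) (f : Finset ι → M) (T : Finset ι) :
    wedge R s f T = if s ∈ T then koszulSign s T • f (T.erase s) else 0 := rfl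

theorem contr_contr (s t : ι) (f : Finset ι → M) :
    contr R s (contr R t f) = -contr R t (contr R s f) := by
  ext T
  simp only [contr_apply, Pi.neg_apply, Finset.mem_insert]
  by_cases hs : s ∈ T <;> by_cases ht : t ∈ T <;> simp only [hs, ht, if_true, if_false, or_true,
    smul_zero, neg_zero]
  by_cases hst : s = t
  · subst hst
    simp
  · simp only [hst, Ne.symm hst, or_false, if_false]
    rw [smul_smul, smul_smul, koszulSign_mul_insert hst hs ht, Finset.insert_comm, neg_smul]

theorem contr_contr_self (s : ι) (f : Finset ι → M) : contr R s (contr R s f) = 0 := by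
  ext T
  simp [contr_apply]

theorem wedge_contr_apply (s : ι) (f : Finset ι → M) (T : Finset ι) :
    wedge R s (contr R s f) T = if s ∈ T then f T else 0 := by
  rw [wedge_apply]
  split_ifs with h
  · rw [contr_apply, if_neg (by simp), smul_smul, koszulSign_erase_self, koszulSign_mul_self,
      one_smul, Finset.insert_erase h]
  · rfl

theorem contr_wedge_self (s : ι) (f : Finset ι → M) :
    contr R s (wedge R s f) = f - wedge R s (contr R s f) := by
  ext T
  rw [Pi.sub_apply, wedge_contr_apply, contr_apply]
  split_ifs with h
  · simp
  · rw [wedge_apply, if_pos (by simp), smul_smul, koszulSign_insert_self, koszulSign_mul_self,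
      one_smul, Finset.erase_insert h, sub_zero]

theorem contr_wedge_of_ne {s t : ι} (hst : s ≠ t) (f : Finset ι → M) :
    contr R s (wedge R t f) = -wedge R t (contr R s f) := by
  ext T
  simp only [contr_apply, wedge_apply, Pi.neg_apply, Finset.mem_insert, Finset.mem_erase]
  by_cases hs : s ∈ T <;> by_cases ht : t ∈ T <;>
    simp only [hs, ht, hst, Ne.symm hst, if_true, if_false, or_true, or_false, ne_eq,
      not_false_eq_true, and_self, and_false, smul_zero, neg_zero]
  obtain ⟨T', hT', rfl⟩ : ∃ T', t ∉ T' ∧ insert t T' = T :=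
    ⟨T.erase t, by simp, Finset.insert_erase ht⟩
  have hs' : s ∉ T' := fun h => hs (Finset.mem_insert_of_mem h)
  rw [Finset.insert_comm, Finset.erase_insert (by simp [hT', Ne.symm hst]),
    Finset.erase_insert hT', smul_smul, smul_smul, ← neg_smul, Finset.insert_comm,
    koszulSign_insert_self]
  congr 1
  have h1 := koszulSign_mul_insert hst hs' hT'
  have h2 : koszulSign t (insert s (insert t T')) = koszulSign t (insert s T') := by
    rw [Finset.insert_comm, koszulSign_insert_self]
  rw [h2, koszulSign_insert hT', koszulSign_insert hs']
  rw [koszulSign_insert hT', koszulSign_insert hs'] at h1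
  rcases lt_or_gt_of_ne hst with h | h
  · simp only [h, h.not_gt, if_true, if_false] at h1 ⊢
    ring
  · simp only [h, h.not_gt, if_true, if_false] at h1 ⊢
    ring

variable [Fintype ι]

/-- The Koszul differential `∑_s y_s ι_s` of the sequence `y`, where `ι_s` is contraction. -/
def bd (y : ι → R) : (Finset ι → M) →ₗ[R] (Finset ι → M) := ∑ s, y s • contr R s

theorem bd_apply (y : ι → R) (f : Finset ι → M) : bd y f = ∑ s, y s • contr R s f := by
  simp [bd]

theorem contr_bd (y : ι → R) (s : ι) (f : Finset ι → M) :
    contr R s (bd y f) = -bd y (contr R s f) := by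
  simp only [bd_apply, map_sum, map_smul, ← Finset.sum_neg_distrib]
  exact Finset.sum_congr rfl fun t _ => by rw [contr_contr, smul_neg]

theorem bd_wedge (y : ι → R) (r : ι) (f : Finset ι → M) :
    bd y (wedge R r f) = y r • f - wedge R r (bd y f) := by
  simp only [bd_apply, map_sum, map_smul]
  rw [← Finset.add_sum_erase _ _ (Finset.mem_univ r),
    ← Finset.add_sum_erase _ (fun s => y s • wedge R r (contr R s f)) (Finset.mem_univ r),
    contr_wedge_self, smul_sub, ← sub_sub, sub_eq_add_neg (_ - _), ← Finset.sum_neg_distrib]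
  congr 1
  refine Finset.sum_congr rfl fun s hs => ?_
  rw [contr_wedge_of_ne (Finset.ne_of_mem_erase hs), smul_neg]

theorem bd_bd (y : ι → R) (f : Finset ι → M) : bd y (bd y f) = 0 := by
  -- Cancelling pairs `(s, t)`, `(t, s)` works in every characteristic: diagonal terms vanish.
  have h : ∀ s, contr R s (bd y f) = ∑ t, y t • contr R s (contr R t f) := fun s => by
    simp [bd_apply]
  rw [bd_apply]
  simp only [h, Finset.smul_sum]
  rw [← Finset.sum_product']
  refine Finset.sum_involution (fun p _ => (p.2, p.1)) ?_ ?_ ?_ ?_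
  · rintro ⟨s, t⟩ _
    dsimp only
    rw [contr_contr t s, smul_neg, smul_neg, smul_comm (y t), add_neg_cancel]
  · rintro ⟨s, t⟩ _ hne heq
    simp only [Prod.mk.injEq] at heq
    obtain ⟨rfl, -⟩ := heq
    exact hne (by simp [contr_contr_self])
  · simp
  · simp

end Operators

/-! ### Cycles, boundaries, and propagation of vanishing -/

section Chains

set_option linter.unusedSectionVars false

variable {K R ι M : Type*} [Field K] [CommRing R] [Algebra K R] [LinearOrder ι]
  [AddCommGroup M] [Module K M] [Module R M] [IsScalarTower K R M]

/-- The elements of `A ⊗ ⋀^a K^W`, for a subspace `A` of `M` and a set `W` of indices. -/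
def chains (A : Submodule K M) (a : ℕ) (W : Finset ι) : Submodule K (Finset ι → M) where
  carrier := {f | (∀ T, f T ∈ A) ∧ ∀ T, f T ≠ 0 → T.card = a ∧ T ⊆ W}
  zero_mem' := ⟨fun _ => A.zero_mem, fun _ h => absurd rfl h⟩
  add_mem' := by
    intro f g hf hg
    refine ⟨fun T => A.add_mem (hf.1 T) (hg.1 T), fun T h => ?_⟩
    by_cases h1 : f T = 0
    · exact hg.2 T fun h2 => h (by simp [h1, h2])
    · exact hf.2 T h1
  smul_mem' := by
    intro c f hf
    exact ⟨fun T => A.smul_mem c (hf.1 T), fun T h => hf.2 T fun h1 => h (by simp [h1])⟩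

theorem chains_mono {A A' : Submodule K M} (hA : A ≤ A') {a : ℕ} {W W' : Finset ι} (hW : W ⊆ W') :
    chains A a W ≤ chains A' a W' :=
  fun _ hf => ⟨fun T => hA (hf.1 T), fun T h => ⟨(hf.2 T h).1, (hf.2 T h).2.trans hW⟩⟩

theorem contr_mem_chains {A : Submodule K M} {a : ℕ} {W : Finset ι} {f : Finset ι → M}
    (hf : f ∈ chains A (a + 1) W) (s : ι) : contr R s f ∈ chains A a (W.erase s) := by
  refine ⟨fun T => ?_, fun T h => ?_⟩
  · rw [contr_apply]
    split_ifs
    · exact A.zero_mem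
    · exact zsmul_mem (hf.1 _) _
  · rw [contr_apply] at h
    split_ifs at h with hs
    · exact absurd rfl h
    · obtain ⟨h1, h2⟩ := hf.2 (insert s T) fun h0 => h (by rw [h0, smul_zero])
      rw [Finset.card_insert_of_notMem hs] at h1
      refine ⟨by omega, fun t ht => Finset.mem_erase.2 ⟨?_, h2 (Finset.mem_insert_of_mem ht)⟩⟩
      rintro rfl
      exact hs ht

theorem contr_mem_chains_insert {A : Submodule K M} {a : ℕ} {W : Finset ι} {r : ι} (hr : r ∉ W)
    {f : Finset ι → M} (hf : f ∈ chains A (a + 1) (insert r W)) :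
    contr R r f ∈ chains A a W := by
  have h := contr_mem_chains (R := R) hf r
  rwa [Finset.erase_insert hr] at h

theorem contr_eq_zero {A : Submodule K M} {a : ℕ} {W : Finset ι} {f : Finset ι → M}
    (hf : f ∈ chains A a W) {s : ι} (hs : s ∉ W) : contr R s f = 0 := by
  ext T
  rw [contr_apply]
  split_ifs with h
  · rfl
  · have : f (insert s T) = 0 := by
      by_contra h0
      exact hs ((hf.2 _ h0).2 (Finset.mem_insert_self s T))
    rw [this, smul_zero, Pi.zero_apply]

theorem contr_eq_zero_of_zero {A : Submodule K M} {W : Finset ι} {f : Finset ι → M}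
    (hf : f ∈ chains A 0 W) (s : ι) : contr R s f = 0 := by
  ext T
  rw [contr_apply]
  split_ifs with h
  · rfl
  · have : f (insert s T) = 0 := by
      by_contra h0
      exact Finset.insert_ne_empty s T (Finset.card_eq_zero.1 (hf.2 _ h0).1)
    rw [this, smul_zero, Pi.zero_apply]

theorem wedge_mem_chains {A : Submodule K M} {a : ℕ} {W : Finset ι} {f : Finset ι → M}
    (hf : f ∈ chains A a W) (r : ι) :
    wedge R r f ∈ chains A (a + 1) (insert r W) := by
  refine ⟨fun T => ?_, fun T h => ?_⟩
  · rw [wedge_apply]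
    split_ifs
    · exact zsmul_mem (hf.1 _) _
    · exact A.zero_mem
  · rw [wedge_apply] at h
    split_ifs at h with hs
    · obtain ⟨h1, h2⟩ := hf.2 (T.erase r) fun h0 => h (by rw [h0, smul_zero])
      refine ⟨?_, ?_⟩
      · rw [← h1, Finset.card_erase_add_one hs]
      · rw [← Finset.insert_erase hs]
        exact Finset.insert_subset_insert r h2
    · exact absurd rfl h

theorem sub_wedge_contr_mem_chains {A : Submodule K M} {a : ℕ} {W : Finset ι} {r : ι}
    {f : Finset ι → M} (hf : f ∈ chains A a (insert r W)) :
    f - wedge R r (contr R r f) ∈ chains A a W := by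
  have h0 : ∀ T, (f - wedge R r (contr R r f)) T = if r ∈ T then 0 else f T := fun T => by
    rw [Pi.sub_apply, wedge_contr_apply]
    split_ifs <;> simp
  refine ⟨fun T => ?_, fun T h => ?_⟩
  · rw [h0]
    split_ifs
    · exact A.zero_mem
    · exact hf.1 T
  · rw [h0] at h
    split_ifs at h with hr
    · exact absurd rfl h
    · exact ⟨(hf.2 T h).1, (Finset.subset_insert_iff_of_notMem hr).1 (hf.2 T h).2⟩

theorem smul_mem_chains {A A' : Submodule K M} {a : ℕ} {W : Finset ι} {f : Finset ι → M}
    (hf : f ∈ chains A a W) {x : R} (hx : ∀ m ∈ A, x • m ∈ A') : x • f ∈ chains A' a W :=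
  ⟨fun T => hx _ (hf.1 T), fun T h => hf.2 T fun h0 => h (by rw [Pi.smul_apply, h0, smul_zero])⟩

variable [Fintype ι]

theorem bd_mem_chains {y : ι → R} {A A' : Submodule K M} (hA : ∀ s, ∀ m ∈ A, y s • m ∈ A')
    {a : ℕ} {W : Finset ι} {f : Finset ι → M} (hf : f ∈ chains A (a + 1) W) :
    bd y f ∈ chains A' a W := by
  rw [bd_apply]
  exact Submodule.sum_mem _ fun s _ => smul_mem_chains
    (chains_mono le_rfl (Finset.erase_subset s W) (contr_mem_chains hf s)) (hA s)

/-- The cycles in `A ⊗ ⋀^a K^W`. -/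
def cyc (y : ι → R) (A : Submodule K M) (a : ℕ) (W : Finset ι) : Submodule K (Finset ι → M) :=
  chains A a W ⊓ LinearMap.ker ((bd y).restrictScalars K)

/-- The boundaries of elements of `A ⊗ ⋀^{a+1} K^W`. -/
def bnd (y : ι → R) (A : Submodule K M) (a : ℕ) (W : Finset ι) : Submodule K (Finset ι → M) :=
  (chains A (a + 1) W).map ((bd y).restrictScalars K)

theorem mem_cyc {y : ι → R} {A : Submodule K M} {a : ℕ} {W : Finset ι} {f : Finset ι → M} :
    f ∈ cyc y A a W ↔ f ∈ chains A a W ∧ bd y f = 0 := Iff.rfl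

theorem mem_bnd {y : ι → R} {A : Submodule K M} {a : ℕ} {W : Finset ι} {f : Finset ι → M} :
    f ∈ bnd y A a W ↔ ∃ g ∈ chains A (a + 1) W, bd y g = f := Iff.rfl

theorem cyc_zero (y : ι → R) (A : Submodule K M) (W : Finset ι) :
    cyc y A 0 W = chains A 0 W := by
  refine le_antisymm inf_le_left fun f hf => mem_cyc.2 ⟨hf, ?_⟩
  rw [bd_apply]
  exact Finset.sum_eq_zero fun s _ => by rw [contr_eq_zero_of_zero hf, smul_zero]

theorem bnd_le_cyc {y : ι → R} {A A' : Submodule K M} (hA : ∀ s, ∀ m ∈ A, y s • m ∈ A')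
    (a : ℕ) (W : Finset ι) : bnd y A a W ≤ cyc y A' a W := by
  rintro _ ⟨g, hg, rfl⟩
  exact ⟨bd_mem_chains hA hg, bd_bd y g⟩

/-- If each form `y_r` kills, modulo boundaries, the cycles of degree `a` on every index set
omitting `r`, then an element of degree `a + 1` is a boundary as soon as all its contractions
are. -/
theorem mem_bnd_of_contr_mem_bnd {y : ι → R} {A : Submodule K M} {a : ℕ}
    (H : ∀ (W : Finset ι) (r : ι), r ∉ W → ∀ z ∈ cyc y A a W, y r • z ∈ bnd y A a W)
    (W : Finset ι) (x : Finset ι → M) (hx : x ∈ chains (⊤ : Submodule K M) (a + 1) W)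
    (hc : ∀ s ∈ W, contr R s x ∈ bnd y A a (W.erase s)) : x ∈ bnd y A (a + 1) W := by
  induction W using Finset.induction_on generalizing x with
  | empty =>
    have : x = 0 := by
      ext T
      by_contra h
      have h1 := hx.2 T h
      rw [Finset.subset_empty.1 h1.2] at h1
      simp at h1
    rw [this]
    exact zero_mem _
  | insert r W hr ih =>
    obtain ⟨b, hb, hbx⟩ := mem_bnd.1 (hc r (Finset.mem_insert_self r W))
    rw [Finset.erase_insert hr] at hb
    -- Subtracting a boundary makes the contraction with index `r` vanish.
    set x' := x + bd y (wedge R r b) with hx'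
    have hx'W : x' ∈ chains (⊤ : Submodule K M) (a + 1) W := by
      have : x' = (x - wedge R r (contr R r x)) + y r • b := by
        rw [hx', bd_wedge, hbx]
        abel
      rw [this]
      exact add_mem (sub_wedge_contr_mem_chains hx)
        (smul_mem_chains hb fun _ _ => Submodule.mem_top)
    have hmem : x' ∈ bnd y A (a + 1) W := by
      refine ih x' hx'W fun s hs => ?_
      have hsr : s ≠ r := fun h => hr (h ▸ hs)
      obtain ⟨c, hc1, hcx⟩ := mem_bnd.1 (hc s (Finset.mem_insert_of_mem hs))
      rw [Finset.erase_insert_of_ne hsr.symm] at hc1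
      have hrs : r ∉ W.erase s := fun h => hr (Finset.mem_of_mem_erase h)
      set u := contr R s b with hu
      have huW : u ∈ chains A a (W.erase s) := contr_mem_chains hb s
      set g := c + wedge R r u with hg
      have hgW : g ∈ chains A (a + 1) (insert r (W.erase s)) :=
        add_mem hc1 (wedge_mem_chains huW r)
      have hgx : bd y g = contr R s x' := by
        rw [hg, hx', map_add, map_add, hcx, contr_bd, contr_wedge_of_ne hsr, map_neg, neg_neg]
      -- This compares the primitives `c` of `contr R s x` and `b` of `contr R r x`.
      have hcyc : contr R r g ∈ cyc y A a (W.erase s) := by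
        refine ⟨contr_mem_chains_insert hrs hgW, ?_⟩
        change bd y (contr R r g) = 0
        have h1 := contr_bd y r g
        rw [hgx, contr_contr, contr_eq_zero hx'W hr, map_zero, neg_zero] at h1
        exact neg_eq_zero.1 h1.symm
      have hsplit : bd y g = bd y (g - wedge R r (contr R r g)) + y r • contr R r g := by
        rw [map_sub, bd_wedge, (mem_cyc.1 hcyc).2, map_zero, sub_zero, sub_add_cancel]
      rw [← hgx, hsplit]
      exact add_mem (mem_bnd.2 ⟨_, sub_wedge_contr_mem_chains hgW, rfl⟩) (H _ r hrs _ hcyc)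
    have hxx : x = x' - bd y (wedge R r b) := by rw [hx', add_sub_cancel_right]
    rw [hxx]
    refine sub_mem ?_ (mem_bnd.2 ⟨_, wedge_mem_chains hb r, rfl⟩)
    exact Submodule.map_mono (chains_mono le_rfl (Finset.subset_insert r W)) hmem

/-- Vanishing of the multiplications by the `y_r` on homology propagates from degree `a` to
degree `a + 1`. -/
theorem smul_mem_bnd_succ {y : ι → R} {A : Submodule K M} {a : ℕ}
    (H : ∀ (W : Finset ι) (r : ι), r ∉ W → ∀ z ∈ cyc y A a W, y r • z ∈ bnd y A a W)
    (W : Finset ι) (r : ι) (hr : r ∉ W) (z : Finset ι → M) (hz : z ∈ cyc y A (a + 1) W) :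
    y r • z ∈ bnd y A (a + 1) W := by
  refine mem_bnd_of_contr_mem_bnd H W _
    (smul_mem_chains hz.1 fun _ _ => Submodule.mem_top) fun s _ => ?_
  rw [map_smul]
  refine H _ r (fun h => hr (Finset.mem_of_mem_erase h)) _ ⟨contr_mem_chains hz.1 s, ?_⟩
  change bd y (contr R s z) = 0
  rw [← neg_eq_zero, ← contr_bd, (mem_cyc.1 hz).2, map_zero]

end Chains

/-! ### Dimensions of subquotients -/

section LinearAlgebra

variable {K E E' : Type*} [Field K] [AddCommGroup E] [Module K E] [AddCommGroup E'] [Module K E']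

theorem finrank_eq_map_add_inf_ker (P : Submodule K E) [FiniteDimensional K P] (f : E →ₗ[K] E') :
    Module.finrank K P =
      Module.finrank K (P.map f) + Module.finrank K ↥(P ⊓ LinearMap.ker f) := by
  have h := LinearMap.finrank_range_add_finrank_ker (f ∘ₗ P.subtype)
  rw [LinearMap.range_comp, Submodule.range_subtype, LinearMap.ker_comp] at h
  rw [← h, ← Submodule.map_comap_subtype, Submodule.finrank_map_subtype_eq]

/-- The dimension of `Z / (B ∩ Z)`, or zero if that is infinite. -/
def quotDim (Z B : Submodule K E) : ℕ := Module.finrank K (Z ⧸ B.submoduleOf Z)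

theorem quotDim_add_finrank {Z B : Submodule K E} [FiniteDimensional K Z] (h : B ≤ Z) :
    quotDim Z B + Module.finrank K B = Module.finrank K Z := by
  rw [quotDim, ← Submodule.finrank_quotient_add_finrank (B.submoduleOf Z),
    (Submodule.submoduleOfEquivOfLe h).finrank_eq]

/-- A linear map carrying `P` onto `Z`, such that `Q ∩ P` is the preimage of `B` in `P`,
identifies `P / (Q ∩ P)` with `Z / (B ∩ Z)`. -/
theorem quotDim_eq_of_map {P Q : Submodule K E} {Z B : Submodule K E'} (f : E →ₗ[K] E')
    (hPZ : P.map f = Z) (h : ∀ x ∈ P, f x ∈ B ↔ x ∈ Q) : quotDim P Q = quotDim Z B := by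
  have hf : ∀ x ∈ P, f x ∈ Z := fun x hx => hPZ ▸ Submodule.mem_map_of_mem hx
  let g : P →ₗ[K] Z ⧸ B.submoduleOf Z := (B.submoduleOf Z).mkQ ∘ₗ f.restrict hf
  have hg : Function.Surjective g := by
    refine (Submodule.mkQ_surjective _).comp ?_
    rintro ⟨z, hz⟩
    rw [← hPZ] at hz
    obtain ⟨x, hx, rfl⟩ := hz
    exact ⟨⟨x, hx⟩, rfl⟩
  have hker : LinearMap.ker g = Q.submoduleOf P := by
    ext ⟨x, hx⟩
    rw [LinearMap.mem_ker, LinearMap.comp_apply, Submodule.mkQ_apply,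
      Submodule.Quotient.mk_eq_zero]
    exact h x hx
  rw [quotDim, quotDim, ← hker]
  exact (g.quotKerEquivOfSurjective hg).finrank_eq

end LinearAlgebra

/-! ### The bound by annihilator numbers and the case of equality -/

section Dimensions

set_option linter.unusedSectionVars false

variable {K R ι M : Type*} [Field K] [CommRing R] [Algebra K R] [LinearOrder ι] [Fintype ι]
  [AddCommGroup M] [Module K M] [Module R M] [IsScalarTower K R M]

instance (A : Submodule K M) [FiniteDimensional K A] (a : ℕ) (W : Finset ι) :
    FiniteDimensional K (chains A a W) := by
  let f : chains A a W →ₗ[K] (Finset ι → A) :=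
    { toFun := fun c T => ⟨c.1 T, c.2.1 T⟩
      map_add' := fun _ _ => rfl
      map_smul' := fun _ _ => rfl }
  refine FiniteDimensional.of_injective f fun c d h => ?_
  ext T
  exact congrArg Subtype.val (congrFun h T)

instance (y : ι → R) (A : Submodule K M) [FiniteDimensional K A] (a : ℕ) (W : Finset ι) :
    FiniteDimensional K (cyc y A a W) :=
  Submodule.finiteDimensional_of_le (inf_le_left : cyc y A a W ≤ chains A a W)

instance (y : ι → R) (A : Submodule K M) [FiniteDimensional K A] (a : ℕ) (W : Finset ι) :
    FiniteDimensional K (bnd y A a W) := by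
  rw [bnd]
  infer_instance

/-- The cycles on `W` that `y_r` multiplies into the boundaries. -/
def killed (y : ι → R) (A : Submodule K M) (a : ℕ) (W : Finset ι) (r : ι) :
    Submodule K (Finset ι → M) :=
  cyc y A a W ⊓ (bnd y A a W).comap ((LinearMap.lsmul R (Finset ι → M) (y r)).restrictScalars K)

theorem mem_killed {y : ι → R} {A : Submodule K M} {a : ℕ} {W : Finset ι} {r : ι}
    {f : Finset ι → M} :
    f ∈ killed y A a W r ↔ f ∈ cyc y A a W ∧ y r • f ∈ bnd y A a W := Iff.rfl

theorem killed_le_cyc (y : ι → R) (A : Submodule K M) (a : ℕ) (W : Finset ι) (r : ι) :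
    killed y A a W r ≤ cyc y A a W := inf_le_left

instance (y : ι → R) (A : Submodule K M) [FiniteDimensional K A] (a : ℕ) (W : Finset ι) (r : ι) :
    FiniteDimensional K (killed y A a W r) :=
  Submodule.finiteDimensional_of_le (killed_le_cyc y A a W r)

/-- The boundaries on `insert r W` that do not involve `e_r`. -/
def bndSup (y : ι → R) (A : Submodule K M) (a : ℕ) (W : Finset ι) (r : ι) :
    Submodule K (Finset ι → M) :=
  bnd y A a W ⊔ (cyc y A a W).map ((LinearMap.lsmul R (Finset ι → M) (y r)).restrictScalars K)

instance (y : ι → R) (A : Submodule K M) [FiniteDimensional K A] (a : ℕ) (W : Finset ι) (r : ι) :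
    FiniteDimensional K (bndSup y A a W r) := by
  rw [bndSup]
  infer_instance

theorem eq_sub_wedge_of_contr_eq_zero {r : ι} {f : Finset ι → M} (h : contr R r f = 0) :
    f - wedge R r (contr R r f) = f := by
  rw [h, map_zero, sub_zero]

/-- Contraction with index `r` maps the cycles on `insert r W` onto `killed y A a W r`, with kernel
the cycles on `W`. -/
theorem finrank_cyc_insert (y : ι → R) (A : Submodule K M) [FiniteDimensional K A] (a : ℕ)
    {W : Finset ι} {r : ι} (hr : r ∉ W) :
    Module.finrank K (cyc y A (a + 1) (insert r W)) =
      Module.finrank K (cyc y A (a + 1) W) + Module.finrank K (killed y A a W r) := by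
  have hker : cyc y A (a + 1) (insert r W) ⊓ LinearMap.ker ((contr R r).restrictScalars K) =
      cyc y A (a + 1) W := by
    refine le_antisymm ?_ ?_
    · rintro c ⟨hc, hc0⟩
      have hc0 : contr R r c = 0 := hc0
      have h := sub_wedge_contr_mem_chains (R := R) hc.1
      rw [eq_sub_wedge_of_contr_eq_zero hc0] at h
      exact ⟨h, hc.2⟩
    · rintro c ⟨hc, hc0⟩
      exact ⟨⟨chains_mono le_rfl (Finset.subset_insert r W) hc, hc0⟩, contr_eq_zero hc hr⟩
  have hmap : (cyc y A (a + 1) (insert r W)).map ((contr R r).restrictScalars K) =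
      killed y A a W r := by
    refine le_antisymm ?_ ?_
    · rintro _ ⟨c, hc, rfl⟩
      rw [SetLike.mem_coe, mem_cyc] at hc
      change contr R r c ∈ _
      have h1 : bd y (contr R r c) = 0 := by
        rw [← neg_eq_zero, ← contr_bd, hc.2, map_zero]
      refine mem_killed.2 ⟨⟨contr_mem_chains_insert hr hc.1, h1⟩, mem_bnd.2
        ⟨-(c - wedge R r (contr R r c)), neg_mem (sub_wedge_contr_mem_chains hc.1), ?_⟩⟩
      rw [map_neg, map_sub, hc.2, bd_wedge, h1, map_zero, sub_zero, zero_sub, neg_neg]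
    · intro z hz
      obtain ⟨hz, hb⟩ := mem_killed.1 hz
      obtain ⟨b, hb, hbz⟩ := mem_bnd.1 hb
      refine ⟨wedge R r z - b, ⟨sub_mem (wedge_mem_chains hz.1 r)
        (chains_mono le_rfl (Finset.subset_insert r W) hb), ?_⟩, ?_⟩
      · change bd y (wedge R r z - b) = 0
        rw [map_sub, bd_wedge, (mem_cyc.1 hz).2, map_zero, sub_zero, hbz, sub_self]
      · change contr R r (wedge R r z - b) = z
        rw [map_sub, contr_wedge_self, contr_eq_zero hz.1 hr, contr_eq_zero hb hr, map_zero,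
          sub_zero, sub_zero]
  rw [finrank_eq_map_add_inf_ker _ ((contr R r).restrictScalars K), hker, hmap, add_comm]

/-- Contraction with index `r` maps the boundaries on `insert r W` onto the boundaries on `W`. -/
theorem finrank_bnd_insert (y : ι → R) (A : Submodule K M) [FiniteDimensional K A] (a : ℕ)
    {W : Finset ι} {r : ι} (hr : r ∉ W) :
    Module.finrank K (bnd y A (a + 1) (insert r W)) =
      Module.finrank K (bnd y A a W) + Module.finrank K (bndSup y A (a + 1) W r) := by
  have hmap : (bnd y A (a + 1) (insert r W)).map ((contr R r).restrictScalars K) =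
      bnd y A a W := by
    refine le_antisymm ?_ ?_
    · rintro _ ⟨_, ⟨g, hg, rfl⟩, rfl⟩
      refine mem_bnd.2 ⟨-contr R r g, neg_mem (contr_mem_chains_insert hr hg), ?_⟩
      rw [map_neg]
      exact (contr_bd y r g).symm
    · rintro _ ⟨b, hb, rfl⟩
      refine ⟨_, mem_bnd.2 ⟨-wedge R r b, neg_mem (wedge_mem_chains hb r), rfl⟩, ?_⟩
      change contr R r (bd y (-wedge R r b)) = bd y b
      rw [contr_bd, map_neg, map_neg, neg_neg, contr_wedge_self, contr_eq_zero hb hr, map_zero,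
        sub_zero]
  have hker : bnd y A (a + 1) (insert r W) ⊓ LinearMap.ker ((contr R r).restrictScalars K) =
      bndSup y A (a + 1) W r := by
    refine le_antisymm ?_ ?_
    · rintro _ ⟨⟨g, hg, rfl⟩, hg0⟩
      have hg0 : contr R r (bd y g) = 0 := hg0
      rw [contr_bd, neg_eq_zero] at hg0
      change bd y g ∈ _
      have hsplit : bd y g = bd y (g - wedge R r (contr R r g)) + y r • contr R r g := by
        rw [map_sub, bd_wedge, hg0, map_zero, sub_zero, sub_add_cancel]
      rw [hsplit]
      exact Submodule.add_mem_sup (mem_bnd.2 ⟨_, sub_wedge_contr_mem_chains hg, rfl⟩)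
        ⟨_, ⟨contr_mem_chains_insert hr hg, hg0⟩, rfl⟩
    · refine sup_le ?_ ?_
      · rintro _ ⟨b, hb, rfl⟩
        refine ⟨mem_bnd.2 ⟨b, chains_mono le_rfl (Finset.subset_insert r W) hb, rfl⟩, ?_⟩
        change contr R r (bd y b) = 0
        rw [contr_bd, contr_eq_zero hb hr, map_zero, neg_zero]
      · rintro _ ⟨z, hz, rfl⟩
        refine ⟨mem_bnd.2 ⟨wedge R r z, wedge_mem_chains hz.1 r, ?_⟩, ?_⟩
        · rw [bd_wedge, (mem_cyc.1 hz).2, map_zero, sub_zero]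
          rfl
        · change contr R r (y r • z) = 0
          rw [map_smul, contr_eq_zero hz.1 hr, smul_zero]
  rw [finrank_eq_map_add_inf_ker _ ((contr R r).restrictScalars K), hker, hmap]

theorem finrank_cyc_empty (y : ι → R) (A : Submodule K M) (a : ℕ) :
    Module.finrank K (cyc y A (a + 1) ∅) = 0 := by
  have : cyc y A (a + 1) ∅ = ⊥ := by
    refine (Submodule.eq_bot_iff _).2 fun f hf => ?_
    ext T
    by_contra h
    obtain ⟨h1, h2⟩ := hf.1.2 T h
    rw [Finset.subset_empty.1 h2] at h1
    simp at h1
  rw [this, finrank_bot]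

/-- The number `∑_{j < p} C(p - 1 - j, a) α_j`. -/
def annihilatorSum (α : ℕ → ℕ) (a p : ℕ) : ℕ := ∑ j ∈ Finset.range p, (p - 1 - j).choose a * α j

theorem annihilatorSum_zero_succ (α : ℕ → ℕ) (p : ℕ) :
    annihilatorSum α 0 (p + 1) = annihilatorSum α 0 p + α p := by
  simp [annihilatorSum, Finset.sum_range_succ]

theorem annihilatorSum_succ_succ (α : ℕ → ℕ) (a p : ℕ) :
    annihilatorSum α (a + 1) (p + 1) =
      annihilatorSum α (a + 1) p + annihilatorSum α a p := by
  rw [annihilatorSum, Finset.sum_range_succ, annihilatorSum, annihilatorSum,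
    ← Finset.sum_add_distrib]
  simp only [Nat.add_sub_cancel, Nat.sub_self, Nat.choose_zero_succ, zero_mul, add_zero]
  refine Finset.sum_congr rfl fun j hj => ?_
  obtain ⟨c, rfl⟩ : ∃ c, p = j + c + 1 := ⟨p - j - 1, by
    have := Finset.mem_range.1 hj
    omega⟩
  have h1 : j + c + 1 - j = c + 1 := by omega
  have h2 : j + c + 1 - 1 - j = c := by omega
  rw [h1, h2, Nat.choose_succ_succ]
  ring

section Strand

variable {y : ι → R} {A₀ A₁ : Submodule K M} [FiniteDimensional K A₀] [FiniteDimensional K A₁]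
  (hA : ∀ s, ∀ m ∈ A₀, y s • m ∈ A₁) {α : ℕ → ℕ}

include hA

/-- The dimension count from the long exact sequence of Koszul homology. -/
theorem quotDim_insert (a : ℕ) {W : Finset ι} {r : ι} (hr : r ∉ W) :
    quotDim (cyc y A₁ (a + 1) (insert r W)) (bnd y A₀ (a + 1) (insert r W)) +
        Module.finrank K (bndSup y A₀ (a + 1) W r) + Module.finrank K (bnd y A₀ a W) =
      quotDim (cyc y A₁ (a + 1) W) (bnd y A₀ (a + 1) W) +
        Module.finrank K (bnd y A₀ (a + 1) W) + Module.finrank K (killed y A₁ a W r) := by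
  have h1 := quotDim_add_finrank (bnd_le_cyc hA (a + 1) W)
  have h2 := quotDim_add_finrank (bnd_le_cyc hA (a + 1) (insert r W))
  rw [finrank_cyc_insert y A₁ a hr, finrank_bnd_insert y A₀ a hr] at h2
  omega

theorem quotDim_empty (a : ℕ) : quotDim (cyc y A₁ (a + 1) ∅) (bnd y A₀ (a + 1) ∅) = 0 := by
  have h1 := quotDim_add_finrank (bnd_le_cyc hA (a + 1) ∅)
  rw [finrank_cyc_empty] at h1
  omega

variable (hα : ∀ (W : Finset ι) (r : ι), r ∉ W →
  Module.finrank K (killed y A₁ 0 W r) = α W.card + Module.finrank K (bnd y A₀ 0 W))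

include hα

/-- The annihilator numbers bound the dimensions of Koszul homology. -/
theorem quotDim_le_annihilatorSum (a : ℕ) (W : Finset ι) :
    quotDim (cyc y A₁ (a + 1) W) (bnd y A₀ (a + 1) W) ≤ annihilatorSum α a W.card := by
  induction W using Finset.induction_on generalizing a with
  | empty => rw [quotDim_empty hA]; exact Nat.zero_le _
  | insert r W hr ih =>
    have h := quotDim_insert hA a hr
    have h1 : Module.finrank K (bnd y A₀ (a + 1) W) ≤
        Module.finrank K (bndSup y A₀ (a + 1) W r) := Submodule.finrank_mono le_sup_left
    rw [Finset.card_insert_of_notMem hr]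
    cases a with
    | zero =>
      rw [hα W r hr] at h
      have h2 := ih 0
      rw [annihilatorSum_zero_succ]
      omega
    | succ a =>
      have h2 := ih (a + 1)
      have h3 := ih a
      have h4 := quotDim_add_finrank (bnd_le_cyc hA (a + 1) W)
      have h5 := Submodule.finrank_mono (killed_le_cyc y A₁ (a + 1) W r)
      rw [annihilatorSum_succ_succ]
      omega

/-- Equality in the bound is inherited by smaller index sets and forces the multiplications by
the `y_r` on homology to vanish. -/
theorem vanishing_of_quotDim_insert_eq (a : ℕ) {W : Finset ι} {r : ι} (hr : r ∉ W)
    (h : quotDim (cyc y A₁ (a + 2) (insert r W)) (bnd y A₀ (a + 2) (insert r W)) =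
      annihilatorSum α (a + 1) (insert r W).card) :
    quotDim (cyc y A₁ (a + 2) W) (bnd y A₀ (a + 2) W) = annihilatorSum α (a + 1) W.card ∧
    (∀ z ∈ cyc y A₁ (a + 1) W, y r • z ∈ bnd y A₁ (a + 1) W) ∧
    ∀ z ∈ cyc y A₀ (a + 2) W, y r • z ∈ bnd y A₀ (a + 2) W := by
  have h0 : quotDim (cyc y A₁ (a + 2) (insert r W)) (bnd y A₀ (a + 2) (insert r W)) +
        Module.finrank K (bndSup y A₀ (a + 2) W r) +
          Module.finrank K (bnd y A₀ (a + 1) W) =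
      quotDim (cyc y A₁ (a + 2) W) (bnd y A₀ (a + 2) W) +
        Module.finrank K (bnd y A₀ (a + 2) W) +
          Module.finrank K (killed y A₁ (a + 1) W r) := quotDim_insert hA (a + 1) hr
  rw [Finset.card_insert_of_notMem hr, annihilatorSum_succ_succ] at h
  have h1 : Module.finrank K (bnd y A₀ (a + 2) W) ≤
      Module.finrank K (bndSup y A₀ (a + 2) W r) := Submodule.finrank_mono le_sup_left
  have h2 : quotDim (cyc y A₁ (a + 2) W) (bnd y A₀ (a + 2) W) ≤
      annihilatorSum α (a + 1) W.card := quotDim_le_annihilatorSum hA hα (a + 1) W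
  have h3 := quotDim_le_annihilatorSum hA hα a W
  have h4 := quotDim_add_finrank (bnd_le_cyc hA (a + 1) W)
  have h5 := Submodule.finrank_mono (killed_le_cyc y A₁ (a + 1) W r)
  refine ⟨by omega, ?_, ?_⟩
  · have h6 : killed y A₁ (a + 1) W r = cyc y A₁ (a + 1) W :=
      Submodule.eq_of_le_of_finrank_eq (killed_le_cyc y A₁ (a + 1) W r) (by omega)
    intro z hz
    rw [← h6] at hz
    exact (mem_killed.1 hz).2
  · have h6 : bnd y A₀ (a + 2) W = bndSup y A₀ (a + 2) W r :=
      Submodule.eq_of_le_of_finrank_eq le_sup_left (by omega)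
    intro z hz
    rw [h6]
    exact Submodule.mem_sup_right ⟨z, hz, rfl⟩

theorem quotDim_eq_of_quotDim_univ_eq (a : ℕ)
    (h : quotDim (cyc y A₁ (a + 2) Finset.univ) (bnd y A₀ (a + 2) Finset.univ) =
      annihilatorSum α (a + 1) (Fintype.card ι)) (W : Finset ι) :
    quotDim (cyc y A₁ (a + 2) W) (bnd y A₀ (a + 2) W) = annihilatorSum α (a + 1) W.card := by
  obtain ⟨V, rfl⟩ : ∃ V, W = Vᶜ := ⟨Wᶜ, (compl_compl W).symm⟩
  induction V using Finset.induction_on with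
  | empty => rw [Finset.compl_empty, h, Finset.card_univ]
  | insert r V hr ih =>
    refine (vanishing_of_quotDim_insert_eq (r := r) hA hα a (by simp) ?_).1
    rw [← Finset.compl_erase, Finset.erase_insert hr, ih]

/-- Equality in the bound in one degree `> 1` forces it in the next degree. -/
theorem quotDim_univ_succ_eq (a : ℕ)
    (h : quotDim (cyc y A₁ (a + 2) Finset.univ) (bnd y A₀ (a + 2) Finset.univ) =
      annihilatorSum α (a + 1) (Fintype.card ι)) :
    quotDim (cyc y A₁ (a + 3) Finset.univ) (bnd y A₀ (a + 3) Finset.univ) =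
      annihilatorSum α (a + 2) (Fintype.card ι) := by
  have hall := quotDim_eq_of_quotDim_univ_eq hA hα a h
  have hv := fun (W : Finset ι) (r : ι) (hr : r ∉ W) =>
    vanishing_of_quotDim_insert_eq hA hα a hr (hall (insert r W))
  have h1 := smul_mem_bnd_succ fun W r hr => (hv W r hr).2.1
  have h2 := smul_mem_bnd_succ fun W r hr => (hv W r hr).2.2
  suffices H : ∀ W : Finset ι, quotDim (cyc y A₁ (a + 3) W) (bnd y A₀ (a + 3) W) =
      annihilatorSum α (a + 2) W.card by
    rw [H, Finset.card_univ]
  intro W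
  induction W using Finset.induction_on with
  | empty => rw [quotDim_empty hA]; simp [annihilatorSum]
  | insert r W hr ih =>
    have h3 : quotDim (cyc y A₁ (a + 3) (insert r W)) (bnd y A₀ (a + 3) (insert r W)) +
          Module.finrank K (bndSup y A₀ (a + 3) W r) +
            Module.finrank K (bnd y A₀ (a + 2) W) =
        quotDim (cyc y A₁ (a + 3) W) (bnd y A₀ (a + 3) W) +
          Module.finrank K (bnd y A₀ (a + 3) W) +
            Module.finrank K (killed y A₁ (a + 2) W r) := quotDim_insert hA (a + 2) hr
    have h4 : killed y A₁ (a + 2) W r = cyc y A₁ (a + 2) W :=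
      le_antisymm (killed_le_cyc _ _ _ _ _) fun z hz => mem_killed.2 ⟨hz, h1 W r hr z hz⟩
    have h5 : bndSup y A₀ (a + 3) W r = bnd y A₀ (a + 3) W := by
      refine sup_eq_left.2 ?_
      rintro _ ⟨z, hz, rfl⟩
      exact h2 W r hr z hz
    have h6 := quotDim_add_finrank (bnd_le_cyc hA (a + 2) W)
    rw [h4, h5, ← h6, hall W, ih] at h3
    have h7 : annihilatorSum α (a + 2) (W.card + 1) =
        annihilatorSum α (a + 2) W.card + annihilatorSum α (a + 1) W.card :=
      annihilatorSum_succ_succ α (a + 1) W.card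
    rw [Finset.card_insert_of_notMem hr, h7]
    omega

end Strand

end Dimensions

/-! ### Dimension shifting in Koszul homology -/

section Shift

set_option linter.unusedSectionVars false

variable {K R ι F N : Type*} [Field K] [CommRing R] [Algebra K R] [LinearOrder ι] [Fintype ι]
  [AddCommGroup F] [Module K F] [Module R F] [IsScalarTower K R F]
  [AddCommGroup N] [Module K N] [Module R N] [IsScalarTower K R N]

theorem contr_compLeft (φ : F →ₗ[R] N) (s : ι) (f : Finset ι → F) :
    contr R s (φ.compLeft (Finset ι) f) = φ.compLeft (Finset ι) (contr R s f) := by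
  ext T
  change (if s ∈ T then 0 else koszulSign s T • φ (f (insert s T))) =
    φ (if s ∈ T then 0 else koszulSign s T • f (insert s T))
  split_ifs
  · rw [map_zero]
  · rw [map_zsmul]

theorem bd_compLeft (y : ι → R) (φ : F →ₗ[R] N) (f : Finset ι → F) :
    bd y (φ.compLeft (Finset ι) f) = φ.compLeft (Finset ι) (bd y f) := by
  simp only [bd_apply, contr_compLeft, map_sum, map_smul]

theorem compLeft_mem_chains (φ : F →ₗ[R] N) {A : Submodule K F} {A' : Submodule K N}
    (h : A.map (φ.restrictScalars K) = A') {a : ℕ} {W : Finset ι} {f : Finset ι → F}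
    (hf : f ∈ chains A a W) : φ.compLeft (Finset ι) f ∈ chains A' a W :=
  ⟨fun T => h ▸ Submodule.mem_map_of_mem (hf.1 T), fun T hT => hf.2 T fun h0 => hT (by
    rw [LinearMap.compLeft_apply, Function.comp_apply, h0, map_zero])⟩

theorem exists_lift_chains (φ : F →ₗ[R] N) {A : Submodule K F} {A' : Submodule K N}
    (h : A.map (φ.restrictScalars K) = A') {a : ℕ} {W : Finset ι} {g : Finset ι → N}
    (hg : g ∈ chains A' a W) : ∃ f ∈ chains A a W, φ.compLeft (Finset ι) f = g := by
  classical
  have h1 : ∀ T, ∃ m ∈ A, φ m = g T := fun T => by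
    have := hg.1 T
    rw [← h] at this
    exact this
  choose m hm hmg using h1
  refine ⟨fun T => if g T = 0 then 0 else m T, ⟨fun T => ?_, fun T hT => ?_⟩, ?_⟩
  · dsimp only
    split_ifs
    · exact A.zero_mem
    · exact hm T
  · exact hg.2 T fun h0 => hT (if_pos h0)
  · ext T
    rw [LinearMap.compLeft_apply, Function.comp_apply]
    split_ifs with h0
    · rw [map_zero, h0]
    · exact hmg T

variable {y : ι → R} (φ : F →ₗ[R] N) {F₀ F₁ F₂ : Submodule K F} {N₀ N₁ : Submodule K N}

theorem compLeft_eq_zero_iff {φ : F →ₗ[R] N} {f : Finset ι → F} :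
    φ.compLeft (Finset ι) f = 0 ↔ ∀ T, f T ∈ LinearMap.ker φ := by
  rw [funext_iff]
  rfl

theorem mem_chains_inf_ker {A : Submodule K F} {a : ℕ} {W : Finset ι} {f : Finset ι → F} :
    f ∈ chains (A ⊓ (LinearMap.ker φ).restrictScalars K) a W ↔
      f ∈ chains A a W ∧ φ.compLeft (Finset ι) f = 0 := by
  rw [compLeft_eq_zero_iff]
  constructor
  · exact fun h => ⟨⟨fun T => (h.1 T).1, h.2⟩, fun T => (h.1 T).2⟩
  · exact fun h => ⟨fun T => ⟨h.1.1 T, h.2 T⟩, h.1.2⟩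

/-- The chains whose image under `φ` is a cycle. -/
def preCyc (y : ι → R) (A : Submodule K F) (a : ℕ) : Submodule K (Finset ι → F) :=
  chains A a Finset.univ ⊓
    LinearMap.ker ((φ.compLeft (Finset ι) ∘ₗ bd y).restrictScalars K)

/-- The chains that are, up to a boundary, in the kernel of `φ`. -/
def preBnd (y : ι → R) (A₀ A₁ : Submodule K F) (a : ℕ) : Submodule K (Finset ι → F) :=
  chains (A₁ ⊓ (LinearMap.ker φ).restrictScalars K) a Finset.univ ⊔ bnd y A₀ a Finset.univ

theorem quotDim_preCyc_eq_image (hy : ∀ s, ∀ m ∈ F₀, y s • m ∈ F₁)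
    (h₀ : F₀.map (φ.restrictScalars K) = N₀) (h₁ : F₁.map (φ.restrictScalars K) = N₁) (a : ℕ) :
    quotDim (preCyc φ y F₁ a) (preBnd φ y F₀ F₁ a) =
      quotDim (cyc y N₁ a Finset.univ) (bnd y N₀ a Finset.univ) := by
  refine quotDim_eq_of_map ((φ.compLeft (Finset ι)).restrictScalars K) (le_antisymm ?_ ?_) ?_
  · rintro _ ⟨f, hf, rfl⟩
    exact ⟨compLeft_mem_chains φ h₁ hf.1, (bd_compLeft y φ f).trans hf.2⟩
  · intro g hg
    obtain ⟨f, hf, rfl⟩ := exists_lift_chains φ h₁ hg.1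
    exact ⟨f, ⟨hf, (bd_compLeft y φ f).symm.trans hg.2⟩, rfl⟩
  · intro f hf
    change φ.compLeft (Finset ι) f ∈ _ ↔ _
    constructor
    · intro h
      obtain ⟨n, hn, hnf⟩ := mem_bnd.1 h
      obtain ⟨g, hg, rfl⟩ := exists_lift_chains φ h₀ hn
      have h2 : f - bd y g ∈ chains (F₁ ⊓ (LinearMap.ker φ).restrictScalars K) a Finset.univ := by
        rw [mem_chains_inf_ker]
        refine ⟨sub_mem hf.1 (bd_mem_chains hy hg), ?_⟩
        rw [map_sub, ← bd_compLeft, hnf, sub_self]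
      rw [← sub_add_cancel f (bd y g)]
      exact Submodule.add_mem_sup h2 (mem_bnd.2 ⟨g, hg, rfl⟩)
    · intro h
      obtain ⟨l, hl, _, ⟨g, hg, rfl⟩, rfl⟩ := Submodule.mem_sup.1 h
      rw [mem_chains_inf_ker] at hl
      rw [map_add, hl.2, zero_add]
      exact mem_bnd.2 ⟨_, compLeft_mem_chains φ h₀ hg, bd_compLeft y φ g⟩

theorem quotDim_preCyc_eq_kernel (hy : ∀ s, ∀ m ∈ F₁, y s • m ∈ F₂) (a : ℕ)
    (hF : cyc y F₁ (a + 1) Finset.univ = bnd y F₀ (a + 1) Finset.univ) :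
    quotDim (preCyc φ y F₁ (a + 1)) (preBnd φ y F₀ F₁ (a + 1)) =
      quotDim (chains (F₂ ⊓ (LinearMap.ker φ).restrictScalars K) a Finset.univ ⊓
          bnd y F₁ a Finset.univ)
        (bnd y (F₁ ⊓ (LinearMap.ker φ).restrictScalars K) a Finset.univ) := by
  refine quotDim_eq_of_map ((bd y).restrictScalars K) (le_antisymm ?_ ?_) ?_
  · rintro _ ⟨f, hf, rfl⟩
    exact ⟨(mem_chains_inf_ker φ).2 ⟨bd_mem_chains hy hf.1, hf.2⟩, mem_bnd.2 ⟨f, hf.1, rfl⟩⟩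
  · rintro _ ⟨hz, ⟨f, hf, rfl⟩⟩
    exact ⟨f, ⟨hf, ((mem_chains_inf_ker φ).1 hz).2⟩, rfl⟩
  · intro f hf
    change bd y f ∈ _ ↔ _
    rw [preBnd, ← hF]
    constructor
    · intro h
      obtain ⟨l, hl, hlf⟩ := mem_bnd.1 h
      rw [← add_sub_cancel l f]
      refine Submodule.add_mem_sup hl ⟨sub_mem hf.1 ((mem_chains_inf_ker φ).1 hl).1, ?_⟩
      change bd y (f - l) = 0
      rw [map_sub, hlf, sub_self]
    · intro h
      obtain ⟨l, hl, z, hz, rfl⟩ := Submodule.mem_sup.1 h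
      rw [map_add, (mem_cyc.1 hz).2, add_zero]
      exact mem_bnd.2 ⟨l, hl, rfl⟩

/-- The connecting isomorphism `H_{a+1}(N) ≅ H_a(ker φ)`, for `a > 0` and acyclic `F`. -/
theorem quotDim_shift (hy₀ : ∀ s, ∀ m ∈ F₀, y s • m ∈ F₁) (hy₁ : ∀ s, ∀ m ∈ F₁, y s • m ∈ F₂)
    (h₀ : F₀.map (φ.restrictScalars K) = N₀) (h₁ : F₁.map (φ.restrictScalars K) = N₁) (a : ℕ)
    (hF₁ : cyc y F₁ (a + 2) Finset.univ = bnd y F₀ (a + 2) Finset.univ)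
    (hF₂ : cyc y F₂ (a + 1) Finset.univ = bnd y F₁ (a + 1) Finset.univ) :
    quotDim (cyc y N₁ (a + 2) Finset.univ) (bnd y N₀ (a + 2) Finset.univ) =
      quotDim (cyc y (F₂ ⊓ (LinearMap.ker φ).restrictScalars K) (a + 1) Finset.univ)
        (bnd y (F₁ ⊓ (LinearMap.ker φ).restrictScalars K) (a + 1) Finset.univ) := by
  rw [← quotDim_preCyc_eq_image φ hy₀ h₀ h₁, quotDim_preCyc_eq_kernel φ hy₁ (a + 1) hF₁, ← hF₂]
  congr 1
  refine le_antisymm (fun f hf => ⟨hf.1, hf.2.2⟩) fun f hf => ⟨hf.1, ?_, hf.2⟩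
  exact ((mem_chains_inf_ker φ).1 hf.1).1

end Shift

/-! ### Acyclicity from division operators -/

section Acyclic

set_option linter.unusedSectionVars false

variable {K R ι F : Type*} [Field K] [CommRing R] [Algebra K R] [LinearOrder ι] [Fintype ι]
  [AddCommGroup F] [Module K F] [Module R F] [IsScalarTower K R F]

theorem contr_comp (D : F →ₗ[K] F) (s : ι) (f : Finset ι → F) :
    contr R s (D.compLeft (Finset ι) f) = D.compLeft (Finset ι) (contr R s f) := by
  ext T
  change (if s ∈ T then 0 else koszulSign s T • D (f (insert s T))) =
    D (if s ∈ T then 0 else koszulSign s T • f (insert s T))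
  split_ifs
  · rw [map_zero]
  · rw [map_zsmul]

variable {y : ι → R} {D : ι → F →ₗ[K] F} (hD : ∀ s f, D s (y s • f) = f)
  (hD' : ∀ r s f, r ≠ s → D r (y s • f) = y s • D r f)

include hD hD'

theorem bd_division (r : ι) {f : Finset ι → F} (hf : bd y f = 0) :
    bd y ((D r).compLeft (Finset ι) f) =
      y r • (D r).compLeft (Finset ι) (contr R r f) - contr R r f := by
  have h : (D r).compLeft (Finset ι) (bd y f) = 0 := by rw [hf, map_zero]
  have h1 : ∀ s, r ≠ s → (D r).compLeft (Finset ι) (y s • contr R s f) =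
      y s • (D r).compLeft (Finset ι) (contr R s f) := fun s hs => by
    ext T
    exact hD' r s _ hs
  have h2 : (D r).compLeft (Finset ι) (y r • contr R r f) = contr R r f := by
    ext T
    exact hD r _
  rw [bd_apply, map_sum, ← Finset.add_sum_erase _ _ (Finset.mem_univ r), h2] at h
  rw [bd_apply, ← Finset.add_sum_erase _ _ (Finset.mem_univ r), contr_comp, sub_eq_add_neg,
    eq_neg_of_add_eq_zero_left h, neg_neg]
  congr 1
  refine Finset.sum_congr rfl fun s hs => ?_
  rw [contr_comp, h1 s (Finset.ne_of_mem_erase hs).symm]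

/-- The operators `e_r D_r`, where `D_r` is division by `y_r`, are homotopies that remove the
basis vectors one at a time. -/
theorem exists_boundary_of_division {A₀ A₁ : Submodule K F} (hy : ∀ s, ∀ m ∈ A₀, y s • m ∈ A₁)
    (hDA : ∀ r, ∀ m ∈ A₁, D r m ∈ A₀) {a : ℕ} {f : Finset ι → F}
    (hf : f ∈ cyc y A₁ a Finset.univ) (V : Finset ι) :
    ∃ g ∈ chains A₀ (a + 1) Finset.univ, ∀ T, ∀ r ∈ V, r ∈ T → (f - bd y g) T = 0 := by
  induction V using Finset.induction_on with
  | empty => exact ⟨0, zero_mem _, fun T r hr => absurd hr (Finset.notMem_empty r)⟩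
  | insert r V hr ih =>
    obtain ⟨g, hg, hgV⟩ := ih
    set f' := f - bd y g with hf'
    have hf'c : bd y f' = 0 := by rw [hf', map_sub, (mem_cyc.1 hf).2, bd_bd, sub_zero]
    have hf'A : f' ∈ chains A₁ a Finset.univ := sub_mem hf.1 (bd_mem_chains hy hg)
    have hDf : (D r).compLeft (Finset ι) f' ∈ chains A₀ a Finset.univ :=
      ⟨fun T => hDA r _ (hf'A.1 T), fun T hT => hf'A.2 T fun h0 => hT (by
        rw [LinearMap.compLeft_apply, Function.comp_apply, h0, map_zero])⟩
    refine ⟨g + wedge R r ((D r).compLeft (Finset ι) f'), add_mem hg (chains_mono le_rfl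
      (Finset.subset_univ _) (wedge_mem_chains hDf r)), fun T t ht htT => ?_⟩
    rw [map_add, ← sub_sub, ← hf', bd_wedge, bd_division hD hD' r hf'c,
      map_sub (wedge R r), map_smul (wedge R r),
      ← contr_comp]
    simp only [Pi.sub_apply, Pi.smul_apply, wedge_contr_apply, LinearMap.compLeft_apply,
      Function.comp_apply]
    by_cases hrT : r ∈ T
    · simp [hrT]
    · have h0 : f' T = 0 := by
        refine hgV T t ((Finset.mem_insert.1 ht).resolve_left ?_) htT
        rintro rfl
        exact hrT htT
      simp [hrT, h0]

/-- A module on which one can divide by the elements `y_r` is acyclic for the Koszul complex. -/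
theorem cyc_eq_bnd_of_division {A₀ A₁ : Submodule K F} (hy : ∀ s, ∀ m ∈ A₀, y s • m ∈ A₁)
    (hDA : ∀ r, ∀ m ∈ A₁, D r m ∈ A₀) (a : ℕ) :
    cyc y A₁ (a + 1) Finset.univ = bnd y A₀ (a + 1) Finset.univ := by
  refine le_antisymm (fun f hf => ?_) (bnd_le_cyc hy _ _)
  obtain ⟨g, hg, h⟩ := exists_boundary_of_division hD hD' hy hDA hf Finset.univ
  refine mem_bnd.2 ⟨g, hg, ?_⟩
  rw [eq_comm, ← sub_eq_zero]
  ext T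
  rcases T.eq_empty_or_nonempty with rfl | ⟨r, hr⟩
  · by_contra h0
    have := (sub_mem hf.1 (bd_mem_chains hy hg)).2 ∅ h0
    simp at this
  · exact h T r (Finset.mem_univ r) hr

end Acyclic

/-! ### The Koszul complex in degree zero -/

section DegreeZero

set_option linter.unusedSectionVars false

variable {K R ι M : Type*} [Field K] [CommRing R] [Algebra K R] [LinearOrder ι] [Fintype ι]
  [AddCommGroup M] [Module K M] [Module R M] [IsScalarTower K R M]

/-- The subspace `∑_{s ∈ W} y_s A` of `M`. -/
def formSpan (y : ι → R) (A : Submodule K M) (W : Finset ι) : Submodule K M :=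
  ⨆ s ∈ W, A.map ((LinearMap.lsmul R M (y s)).restrictScalars K)

theorem smul_mem_formSpan {y : ι → R} {A : Submodule K M} {W : Finset ι} {s : ι} (hs : s ∈ W)
    {m : M} (hm : m ∈ A) : y s • m ∈ formSpan y A W :=
  Submodule.mem_iSup_of_mem s (Submodule.mem_iSup_of_mem hs ⟨m, hm, rfl⟩)

theorem formSpan_le {y : ι → R} {A B : Submodule K M} {W : Finset ι}
    (h : ∀ s ∈ W, ∀ m ∈ A, y s • m ∈ B) : formSpan y A W ≤ B := by
  refine iSup₂_le fun s hs => ?_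
  rintro _ ⟨m, hm, rfl⟩
  exact h s hs m hm

theorem single_empty_injective (K ι M : Type*) [Field K] [LinearOrder ι] [AddCommGroup M]
    [Module K M] : Function.Injective (LinearMap.single K (fun _ : Finset ι => M) ∅) :=
  Pi.single_injective (M := fun _ : Finset ι => M) ∅

theorem single_mem_chains_zero {A : Submodule K M} {W : Finset ι} {m : M} :
    LinearMap.single K (fun _ : Finset ι => M) ∅ m ∈ chains A 0 W ↔ m ∈ A := by
  constructor
  · intro h
    simpa using h.1 ∅
  · intro h
    refine ⟨fun T => ?_, fun T hT => ?_⟩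
    · by_cases hT : T = ∅
      · subst hT
        simpa using h
      · rw [LinearMap.single_apply, Pi.single_eq_of_ne hT]
        exact A.zero_mem
    · by_cases hT' : T = ∅
      · subst hT'
        simp
      · rw [LinearMap.single_apply, Pi.single_eq_of_ne hT'] at hT
        exact absurd rfl hT

theorem eq_single_of_mem_chains_zero {A : Submodule K M} {W : Finset ι} {f : Finset ι → M}
    (hf : f ∈ chains A 0 W) : f = LinearMap.single K (fun _ : Finset ι => M) ∅ (f ∅) := by
  ext T
  by_cases hT : T = ∅
  · subst hT
    simp
  · rw [LinearMap.single_apply, Pi.single_eq_of_ne hT]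
    by_contra h
    exact hT (Finset.card_eq_zero.1 (hf.2 T h).1)

theorem chains_zero (A : Submodule K M) (W : Finset ι) :
    chains A 0 W = A.map (LinearMap.single K (fun _ : Finset ι => M) ∅) := by
  refine le_antisymm (fun f hf => ?_) ?_
  · rw [eq_single_of_mem_chains_zero hf]
    exact Submodule.mem_map_of_mem (hf.1 ∅)
  · rintro _ ⟨m, hm, rfl⟩
    exact single_mem_chains_zero.2 hm

theorem bnd_zero (y : ι → R) (A : Submodule K M) (W : Finset ι) :
    bnd y A 0 W = (formSpan y A W).map (LinearMap.single K (fun _ : Finset ι => M) ∅) := by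
  refine le_antisymm ?_ ?_
  · rintro _ ⟨g, hg, rfl⟩
    have h1 : bd y g ∈ chains (formSpan y A W) 0 W := by
      rw [bd_apply]
      refine Submodule.sum_mem _ fun s _ => ?_
      by_cases hs : s ∈ W
      · exact smul_mem_chains (chains_mono le_rfl (Finset.erase_subset s W)
          (contr_mem_chains hg s)) fun m hm => smul_mem_formSpan hs hm
      · rw [contr_eq_zero hg hs, smul_zero]
        exact zero_mem _
    rw [chains_zero] at h1
    exact h1
  · rw [Submodule.map_le_iff_le_comap]
    refine formSpan_le fun s hs m hm => ?_
    refine mem_bnd.2 ⟨wedge R s (LinearMap.single K (fun _ : Finset ι => M) ∅ m),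
      chains_mono le_rfl (Finset.insert_subset hs (Finset.empty_subset W))
        (wedge_mem_chains (single_mem_chains_zero (W := ∅).2 hm) s), ?_⟩
    have h0 : LinearMap.single K (fun _ : Finset ι => M) ∅ m ∈ cyc y A 0 ∅ := by
      rw [cyc_zero]
      exact single_mem_chains_zero.2 hm
    rw [bd_wedge, (mem_cyc.1 h0).2, map_zero, sub_zero]
    ext T
    by_cases hT : T = ∅
    · subst hT
      simp
    · simp [Pi.single_eq_of_ne hT]

theorem single_mem_bnd_zero {y : ι → R} {A : Submodule K M} {W : Finset ι} {m : M} :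
    LinearMap.single K (fun _ : Finset ι => M) ∅ m ∈ bnd y A 0 W ↔ m ∈ formSpan y A W := by
  rw [bnd_zero]
  exact Function.Injective.mem_set_image (Pi.single_injective (∅ : Finset ι))

theorem finrank_bnd_zero (y : ι → R) (A : Submodule K M) (W : Finset ι) :
    Module.finrank K (bnd y A 0 W) = Module.finrank K (formSpan y A W) := by
  rw [bnd_zero]
  exact (Submodule.equivMapOfInjective _ (single_empty_injective K ι M) _).finrank_eq.symm

theorem finrank_killed_zero (y : ι → R) (A : Submodule K M) (W : Finset ι) (r : ι) :
    Module.finrank K (killed y A 0 W r) = Module.finrank K ↥(A ⊓ (formSpan y A W).comap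
      ((LinearMap.lsmul R M (y r)).restrictScalars K)) := by
  have h : killed y A 0 W r = (A ⊓ (formSpan y A W).comap
      ((LinearMap.lsmul R M (y r)).restrictScalars K)).map
        (LinearMap.single K (fun _ : Finset ι => M) ∅) := by
    have hsmul : ∀ m : M, y r • LinearMap.single K (fun _ : Finset ι => M) ∅ m =
        LinearMap.single K (fun _ : Finset ι => M) ∅ (y r • m) := fun m =>
      (Pi.single_smul' ∅ (y r) m).symm
    refine le_antisymm (fun f hf => ?_) ?_
    · obtain ⟨hc, hb⟩ := mem_killed.1 hf
      have hc' := hc.1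
      rw [eq_single_of_mem_chains_zero hc', hsmul, single_mem_bnd_zero] at hb
      rw [eq_single_of_mem_chains_zero hc']
      exact Submodule.mem_map_of_mem ⟨hc'.1 ∅, hb⟩
    · rintro _ ⟨m, ⟨hm, hm'⟩, rfl⟩
      refine mem_killed.2 ⟨?_, ?_⟩
      · rw [cyc_zero]
        exact single_mem_chains_zero.2 hm
      · rw [hsmul, single_mem_bnd_zero]
        exact hm'
  rw [h]
  exact (Submodule.equivMapOfInjective _ (single_empty_injective K ι M) _).finrank_eq.symm

end DegreeZero

/-! ### Graded free modules over the polynomial ring -/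

section Division

open MvPolynomial

variable {K : Type*} [Field K] {n : ℕ}

/-- The linear forms `y_1, …, y_n` are coordinates of the polynomial ring: they are the images of
the variables under an automorphism that preserves degrees. -/
structure LinearCoordinates (y : Fin n → MvPolynomial (Fin n) K) where
  equiv : MvPolynomial (Fin n) K ≃ₐ[K] MvPolynomial (Fin n) K
  equiv_X : ∀ s, equiv (X s) = y s
  isHomogeneous : ∀ s, (y s).IsHomogeneous 1
  isHomogeneous_symm : ∀ s, (equiv.symm (X s)).IsHomogeneous 1

theorem degree_eq_of_isHomogeneous {p : MvPolynomial (Fin n) K} {d : ℕ} (hp : p.IsHomogeneous d)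
    {c : Fin n →₀ ℕ} (hc : coeff c p ≠ 0) : c.degree = d := by
  by_contra h
  exact hc (hp.coeff_eq_zero h)

theorem coeff_algHom_ne_zero (φ : MvPolynomial (Fin n) K →ₐ[K] MvPolynomial (Fin n) K)
    (hφ : ∀ s, (φ (X s)).IsHomogeneous 1) {p : MvPolynomial (Fin n) K} {d : ℤ}
    (hp : ∀ c, coeff c p ≠ 0 → (c.degree : ℤ) = d) (c : Fin n →₀ ℕ) (hc : coeff c (φ p) ≠ 0) :
    (c.degree : ℤ) = d := by
  obtain ⟨c₀, hc₀⟩ : ∃ c₀, coeff c₀ p ≠ 0 := by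
    by_contra! h
    have hp0 : p = 0 := by
      ext m
      simpa using h m
    rw [hp0, map_zero, coeff_zero] at hc
    exact hc rfl
  have hpd : p.IsHomogeneous c₀.degree := by
    intro m hm
    have h1 := hp m hm
    rw [← hp c₀ hc₀] at h1
    exact (DFunLike.congr_fun (Finsupp.degree_eq_weight_one (R := ℕ)) m).symm.trans
      (by exact_mod_cast h1)
  have h := hpd.aeval (fun s => φ (X s)) hφ
  have haev : MvPolynomial.aeval (fun s => φ (X s)) p = φ p := by
    rw [← MvPolynomial.comp_aeval_apply, aeval_X_left_apply]
  rw [haev, one_mul] at h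
  rw [← hp c₀ hc₀, degree_eq_of_isHomogeneous h hc]

/-- Division by the variable `x_r`, discarding the monomials not divisible by `x_r`. -/
def divX (r : Fin n) : MvPolynomial (Fin n) K →ₗ[K] MvPolynomial (Fin n) K where
  toFun p := p.divMonomial (Finsupp.single r 1)
  map_add' p q := add_divMonomial p q _
  map_smul' a p := by
    ext m
    simp [coeff_divMonomial]

theorem divX_X_mul (r : Fin n) (p : MvPolynomial (Fin n) K) : divX r (X r * p) = p :=
  X_mul_divMonomial r p

theorem divX_X_mul_of_ne {r s : Fin n} (h : r ≠ s) (p : MvPolynomial (Fin n) K) :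
    divX r (X s * p) = X s * divX r p := by
  ext m
  change coeff m ((X s * p).divMonomial _) = coeff m (X s * p.divMonomial _)
  rw [coeff_divMonomial, coeff_X_mul', coeff_X_mul', coeff_divMonomial]
  have hs : s ∈ (Finsupp.single r 1 + m).support ↔ s ∈ m.support := by
    simp [Finsupp.mem_support_iff, h]
  by_cases hsm : s ∈ m.support
  · rw [if_pos (hs.2 hsm), if_pos hsm, add_tsub_assoc_of_le]
    rw [Finsupp.single_le_iff]
    exact Nat.one_le_iff_ne_zero.2 (Finsupp.mem_support_iff.1 hsm)
  · rw [if_neg fun h' => hsm (hs.1 h'), if_neg hsm]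

variable {y : Fin n → MvPolynomial (Fin n) K} (θ : LinearCoordinates y)

/-- Division by the linear form `y_r` in the coordinates `y`. -/
def divForm (r : Fin n) : MvPolynomial (Fin n) K →ₗ[K] MvPolynomial (Fin n) K :=
  θ.equiv.toLinearMap ∘ₗ divX r ∘ₗ θ.equiv.symm.toLinearMap

theorem divForm_apply (r : Fin n) (p : MvPolynomial (Fin n) K) :
    divForm θ r p = θ.equiv (divX r (θ.equiv.symm p)) := rfl

theorem equiv_symm_form (s : Fin n) : θ.equiv.symm (y s) = X s := by
  rw [← θ.equiv_X, AlgEquiv.symm_apply_apply]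

theorem divForm_mul (r : Fin n) (p : MvPolynomial (Fin n) K) : divForm θ r (y r * p) = p := by
  rw [divForm_apply, map_mul, equiv_symm_form, divX_X_mul, AlgEquiv.apply_symm_apply]

theorem divForm_mul_of_ne {r s : Fin n} (h : r ≠ s) (p : MvPolynomial (Fin n) K) :
    divForm θ r (y s * p) = y s * divForm θ r p := by
  rw [divForm_apply, map_mul, equiv_symm_form, divX_X_mul_of_ne h, map_mul, θ.equiv_X,
    divForm_apply]

theorem coeff_divForm_ne_zero (r : Fin n) {p : MvPolynomial (Fin n) K} {d : ℤ}
    (hp : ∀ c, coeff c p ≠ 0 → (c.degree : ℤ) = d) (c : Fin n →₀ ℕ)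
    (hc : coeff c (divForm θ r p) ≠ 0) : (c.degree : ℤ) = d - 1 := by
  refine coeff_algHom_ne_zero θ.equiv.toAlgHom
    (fun s => by simpa [θ.equiv_X] using θ.isHomogeneous s) ?_ c hc
  intro m hm
  change coeff m ((θ.equiv.symm p).divMonomial _) ≠ 0 at hm
  rw [coeff_divMonomial] at hm
  have h := coeff_algHom_ne_zero θ.equiv.symm.toAlgHom θ.isHomogeneous_symm hp _ hm
  rw [map_add, Finsupp.degree_single] at h
  push_cast at h
  linarith

universe w

variable {ι : Type w} {deg : ι → ℤ}

/-- Division by `y_r` in each coordinate of a free module. -/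
def divFree (ι : Type w) (r : Fin n) :
    (ι →₀ MvPolynomial (Fin n) K) →ₗ[K] (ι →₀ MvPolynomial (Fin n) K) :=
  Finsupp.mapRange.linearMap (divForm θ r)

theorem divFree_mem_freePart (r : Fin n) {j : ℤ} {f : ι →₀ MvPolynomial (Fin n) K}
    (hf : f ∈ freePart deg (j + 1)) : divFree θ ι r f ∈ freePart deg j := by
  intro e c hc
  have h := coeff_divForm_ne_zero θ r (d := j + 1 - deg e)
    (fun c' hc' => by rw [← hf e c' hc']; ring) c hc
  rw [h]
  ring

theorem smul_mem_freePart {p : MvPolynomial (Fin n) K} (hp : p.IsHomogeneous 1) {j : ℤ}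
    {f : ι →₀ MvPolynomial (Fin n) K} (hf : f ∈ freePart deg j) :
    p • f ∈ freePart (K := K) deg (j + 1) := by
  rw [MvPolynomial.as_sum p, Finset.sum_smul]
  refine Submodule.sum_mem _ fun c hc => ?_
  have h := freePart_monomial_smul deg c (coeff c p) j f hf
  have hd : c.degree = 1 := degree_eq_of_isHomogeneous hp (mem_support_iff.1 hc)
  rwa [hd, Nat.cast_one, add_comm] at h

include θ

/-- Koszul acyclicity of graded free modules. -/
theorem cyc_freePart_eq_bnd (j : ℤ) (a : ℕ) :
    cyc y (freePart (K := K) (n := n) deg (j + 1)) (a + 1) Finset.univ =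
      bnd y (freePart (K := K) (n := n) deg j) (a + 1) Finset.univ := by
  refine cyc_eq_bnd_of_division (D := fun r => divFree θ ι r) (fun s f => ?_)
    (fun r s f hrs => ?_) (fun s f hf => smul_mem_freePart (θ.isHomogeneous s) hf)
    (fun r f hf => divFree_mem_freePart θ r hf) a
  · ext1 e
    exact divForm_mul θ s (f e)
  · ext1 e
    exact divForm_mul_of_ne θ hrs (f e)

theorem X_mem_span_range (l : Fin n) : (X l : MvPolynomial (Fin n) K) ∈
    Submodule.span K (Set.range y) := by
  have h : θ.equiv.symm (X l) ∈ homogeneousSubmodule (Fin n) K 1 := θ.isHomogeneous_symm l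
  rw [homogeneousSubmodule_one_eq_span_X] at h
  have h1 := Submodule.mem_map_of_mem (f := θ.equiv.toLinearMap) h
  rw [Submodule.map_span, ← Set.range_comp] at h1
  have h2 : (θ.equiv.toLinearMap ∘ X : Fin n → MvPolynomial (Fin n) K) = y :=
    funext θ.equiv_X
  rw [h2] at h1
  simpa using h1

theorem X_smul_mem_formSpan {N : Type*} [AddCommGroup N] [Module K N]
    [Module (MvPolynomial (Fin n) K) N] [IsScalarTower K (MvPolynomial (Fin n) K) N]
    (A : Submodule K N) (l : Fin n) {m : N} (hm : m ∈ A) :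
    (X l : MvPolynomial (Fin n) K) • m ∈ formSpan y A Finset.univ := by
  have h : Submodule.span K (Set.range y) ≤ (formSpan y A Finset.univ).comap
      ((LinearMap.toSpanSingleton (MvPolynomial (Fin n) K) N m).restrictScalars K) := by
    rw [Submodule.span_le]
    rintro _ ⟨s, rfl⟩
    exact smul_mem_formSpan (Finset.mem_univ s) hm
  exact h (X_mem_span_range θ l)

theorem mem_formSpan_of_constantCoeff {j : ℤ} {f : ι →₀ MvPolynomial (Fin n) K}
    (hf : f ∈ freePart deg (j + 1)) (h0 : ∀ e, constantCoeff (f e) = 0) :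
    f ∈ formSpan y (freePart (K := K) deg j) Finset.univ := by
  rw [← Finsupp.sum_single f]
  refine Submodule.sum_mem _ fun e _ => ?_
  rw [MvPolynomial.as_sum (f e), ← Finsupp.singleAddHom_apply, map_sum]
  refine Submodule.sum_mem _ fun c hc => ?_
  have hc' := mem_support_iff.1 hc
  obtain ⟨l, hl⟩ : ∃ l, c l ≠ 0 := by
    by_contra! h
    have hc0 : c = 0 := Finsupp.ext h
    rw [hc0] at hc'
    exact hc' (h0 e)
  have hle : Finsupp.single l 1 ≤ c := Finsupp.single_le_iff.2 (Nat.one_le_iff_ne_zero.2 hl)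
  have hdeg : c.degree = 1 + (c - Finsupp.single l 1).degree := by
    conv_lhs => rw [← add_tsub_cancel_of_le hle, map_add, Finsupp.degree_single]
  have h1 : Finsupp.single e (monomial (c - Finsupp.single l 1) (coeff c (f e))) ∈
      freePart (K := K) deg j := by
    have h2 := freePart_single_monomial (K := K) deg e (c - Finsupp.single l 1) (coeff c (f e))
    have h3 := hf e c hc'
    have h4 : ((c - Finsupp.single l 1).degree : ℤ) + deg e = j := by
      rw [hdeg] at h3
      push_cast at h3
      linarith
    rwa [h4] at h2
  have h5 := X_smul_mem_formSpan θ _ l h1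
  rw [Finsupp.smul_single, smul_eq_mul, X, monomial_mul, add_tsub_cancel_of_le hle, one_mul] at h5
  exact h5

omit θ in
theorem one_tmul_form_smul (hy : ∀ s, (y s).IsHomogeneous 1) (s : Fin n)
    (f : ι →₀ MvPolynomial (Fin n) K) :
    TensorProduct.mk (MvPolynomial (Fin n) K) (ResidueModule K n) _
      (ResidueModule.one K n) (y s • f) = 0 := by
  have h0 : y s • ResidueModule.one K n = 0 := by
    rw [ResidueModule.smul_def]
    have : constantCoeff (y s) = 0 := by
      rw [constantCoeff_eq]
      by_contra h
      have := hy s h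
      simp at this
    rw [this, zero_smul]
  rw [TensorProduct.mk_apply, ← TensorProduct.smul_tmul, h0, TensorProduct.zero_tmul]

omit θ in
theorem constantCoeff_eq_zero_of_one_tmul {f : ι →₀ MvPolynomial (Fin n) K}
    (hf : TensorProduct.mk (MvPolynomial (Fin n) K) (ResidueModule K n) _
      (ResidueModule.one K n) f = 0) (e : ι) : constantCoeff (f e) = 0 := by
  have h := congrArg (fun t => TensorProduct.rid (MvPolynomial (Fin n) K) (ResidueModule K n)
    ((Finsupp.lapply (R := MvPolynomial (Fin n) K) e).lTensor (ResidueModule K n) t)) hf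
  simp only [TensorProduct.mk_apply, LinearMap.lTensor_tmul, Finsupp.lapply_apply,
    TensorProduct.rid_tmul, map_zero] at h
  rw [ResidueModule.smul_def] at h
  change constantCoeff (f e) * (1 : K) = 0 at h
  rwa [mul_one] at h

theorem one_tmul_eq_zero_iff {j : ℤ} {f : ι →₀ MvPolynomial (Fin n) K}
    (hf : f ∈ freePart deg (j + 1)) :
    TensorProduct.mk (MvPolynomial (Fin n) K) (ResidueModule K n) _ (ResidueModule.one K n) f = 0 ↔
      f ∈ formSpan y (freePart (K := K) deg j) Finset.univ := by
  constructor
  · exact fun h => mem_formSpan_of_constantCoeff θ hf (constantCoeff_eq_zero_of_one_tmul h)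
  · intro h
    have hle : formSpan y (freePart (K := K) deg j) Finset.univ ≤ LinearMap.ker
        ((TensorProduct.mk (MvPolynomial (Fin n) K) (ResidueModule K n)
          (ι →₀ MvPolynomial (Fin n) K) (ResidueModule.one K n)).restrictScalars K) :=
      formSpan_le fun s _ m _ => one_tmul_form_smul θ.isHomogeneous s m
    exact hle h

end Division

/-! ### Linear forms with invertible coefficient matrix -/

section Coordinates

open MvPolynomial

variable {K : Type*} [Field K] {n : ℕ}

theorem isHomogeneous_linearForm (c : Fin n × Fin n → K) (p : Fin n) :
    (linearForm c p).IsHomogeneous 1 := by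
  refine IsHomogeneous.sum _ _ _ fun l _ => ?_
  rw [smul_eq_C_mul]
  exact isHomogeneous_C_mul_X _ _

theorem aeval_linearForm (c d : Fin n × Fin n → K)
    (h : (Matrix.of fun p l => d (p, l)) * (Matrix.of fun p l => c (p, l)) = 1) (s : Fin n) :
    aeval (linearForm c) (linearForm d s) = X s := by
  simp only [linearForm, map_sum, map_smul, aeval_X, Finset.smul_sum, smul_smul]
  rw [Finset.sum_comm]
  simp only [← Finset.sum_smul]
  have h1 : ∀ l, ∑ x, d (s, x) * c (x, l) = (1 : Matrix (Fin n) (Fin n) K) s l := fun l => by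
    rw [← h]
    rfl
  simp only [h1, Matrix.one_apply]
  simp

/-- Linear forms with invertible coefficient matrix are coordinates. -/
def linearCoordinates (c : Fin n × Fin n → K)
    (hc : (Matrix.of fun p l => c (p, l)).det ≠ 0) : LinearCoordinates (linearForm c) :=
  let d : Fin n × Fin n → K := fun q => (Matrix.of fun p l => c (p, l))⁻¹ q.1 q.2
  have hd : (Matrix.of fun p l => d (p, l)) = (Matrix.of fun p l => c (p, l))⁻¹ := rfl
  have hu : IsUnit (Matrix.of fun p l => c (p, l)).det := isUnit_iff_ne_zero.2 hc
  { equiv := AlgEquiv.ofAlgHom (aeval (linearForm c)) (aeval (linearForm d))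
      (by
        ext s : 1
        rw [AlgHom.comp_apply, aeval_X, AlgHom.id_apply]
        exact aeval_linearForm c d (by rw [hd, Matrix.nonsing_inv_mul _ hu]) s)
      (by
        ext s : 1
        rw [AlgHom.comp_apply, aeval_X, AlgHom.id_apply]
        exact aeval_linearForm d c (by rw [hd, Matrix.mul_nonsing_inv _ hu]) s)
    equiv_X := fun s => aeval_X _ _
    isHomogeneous := isHomogeneous_linearForm c
    isHomogeneous_symm := fun s => by
      change (aeval (linearForm d) (X s : MvPolynomial (Fin n) K)).IsHomogeneous 1
      rw [aeval_X]
      exact isHomogeneous_linearForm d s }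

end Coordinates

/-! ### Homogeneous lifts -/

section Lifting

open MvPolynomial

variable {K : Type*} [Field K] {n : ℕ} {N ι : Type*} [AddCommGroup N] [Module K N]
  [Module (MvPolynomial (Fin n) K) N]

omit [Module (MvPolynomial (Fin n) K) N] in
theorem mem_of_mem_iSup_of_le {𝓝 𝓖 : ℤ → Submodule K N} (h𝓝 : iSupIndep 𝓝)
    (h𝓖 : ∀ j, 𝓖 j ≤ 𝓝 j) {j : ℤ} {x : N} (hx : x ∈ 𝓝 j) (hx' : x ∈ ⨆ j, 𝓖 j) : x ∈ 𝓖 j := by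
  classical
  rw [Submodule.mem_iSup_iff_exists_finsupp] at hx'
  obtain ⟨f, hf, hfx⟩ := hx'
  have h := (iSupIndep_iff_finsetSum_eq_zero_imp_eq_zero 𝓝).1 h𝓝 (insert j f.support)
    (fun i => f i - if i = j then x else 0) ?_ ?_ j (Finset.mem_insert_self _ _)
  · simp only [if_true, sub_eq_zero] at h
    exact h ▸ hf j
  · intro i _
    refine sub_mem (h𝓖 i (hf i)) ?_
    split_ifs with hij
    · rw [hij]
      exact hx
    · exact zero_mem _
  · rw [Finset.sum_sub_distrib, Finset.sum_ite_eq', if_pos (Finset.mem_insert_self _ _),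
      sub_eq_zero, ← hfx, Finsupp.sum]
    refine (Finset.sum_subset (Finset.subset_insert _ _) fun i _ hi => ?_).symm
    exact Finsupp.notMem_support_iff.1 hi

/-- A homogeneous element in the image of a graded map is the image of a homogeneous element. -/
theorem exists_homogeneous_lift [IsScalarTower K (MvPolynomial (Fin n) K) N] {deg : ι → ℤ}
    {𝓝 : ℤ → Submodule K N} (h𝓝 : iSupIndep 𝓝)
    (φ : (ι →₀ MvPolynomial (Fin n) K) →ₗ[MvPolynomial (Fin n) K] N)
    (hφ : ∀ j, ∀ x ∈ freePart deg j, φ x ∈ 𝓝 j) {j : ℤ} {x : N} (hx : x ∈ 𝓝 j)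
    (hxφ : x ∈ LinearMap.range φ) : ∃ f ∈ freePart (K := K) deg j, φ f = x := by
  refine mem_of_mem_iSup_of_le (𝓖 := fun j => (freePart deg j).map (φ.restrictScalars K)) h𝓝
    (fun j => ?_) hx ?_
  · rintro _ ⟨y, hy, rfl⟩
    exact hφ j y hy
  · obtain ⟨g, rfl⟩ := hxφ
    rw [← Submodule.map_iSup, freePart_iSup]
    exact ⟨g, trivial, rfl⟩

end Lifting

/-! ### Tor as Koszul homology -/

section Tor

set_option linter.unusedSectionVars false

open MvPolynomial

universe u v

variable {K : Type u} [Field K] {n : ℕ} {M : Type v} [AddCommGroup M] [Module K M]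
  [Module (MvPolynomial (Fin n) K) M] [IsScalarTower K (MvPolynomial (Fin n) K) M]
  {𝓜 : ℤ → Submodule K M}

namespace GradedFreeResolution

/-- The homogeneous parts of the syzygy modules of `M`: the kernel of `F_0 → M`, and the kernels
of `F_{i+1} → F_i`. -/
def syz (F : GradedFreeResolution (n := n) 𝓜) : (i : ℕ) → (j : ℤ) →
    Submodule K (F.ι i →₀ MvPolynomial (Fin n) K)
  | 0, j => freePart (F.deg 0) j ⊓ (LinearMap.ker F.aug).restrictScalars K
  | i + 1, j => freePart (F.deg (i + 1)) j ⊓ (LinearMap.ker (F.d i)).restrictScalars K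

variable (F : GradedFreeResolution (n := n) 𝓜)

theorem syz_le (i : ℕ) (j : ℤ) : F.syz i j ≤ freePart (F.deg i) j := by
  cases i <;> exact inf_le_left

theorem map_aug [IsGradedModule (n := n) 𝓜] (j : ℤ) :
    (freePart (F.deg 0) j).map (F.aug.restrictScalars K) = 𝓜 j := by
  refine le_antisymm ?_ fun x hx => ?_
  · rintro _ ⟨x, hx, rfl⟩
    exact F.aug_mem j x hx
  · exact exists_homogeneous_lift
      (IsGradedModule.isInternal (n := n) (𝓜 := 𝓜)).submodule_iSupIndep F.aug F.aug_mem hx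
      (F.aug_surjective x)

theorem map_d (i : ℕ) (j : ℤ) :
    (freePart (F.deg (i + 1)) j).map ((F.d i).restrictScalars K) = F.syz i j := by
  have hker : ∀ x ∈ freePart (F.deg i) j, x ∈ F.syz i j ↔ x ∈ LinearMap.range (F.d i) := by
    intro x hx
    cases i with
    | zero => rw [← LinearMap.exact_iff.1 F.exact_zero]; exact ⟨fun h => h.2, fun h => ⟨hx, h⟩⟩
    | succ i =>
      rw [← LinearMap.exact_iff.1 (F.exact_succ i)]
      exact ⟨fun h => h.2, fun h => ⟨hx, h⟩⟩
  refine le_antisymm ?_ fun x hx => ?_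
  · rintro _ ⟨x, hx, rfl⟩
    exact (hker _ (F.d_mem i j x hx)).2 ⟨x, rfl⟩
  · exact exists_homogeneous_lift (freePart_iSupIndep _) (F.d i) (F.d_mem i) (F.syz_le i j hx)
      ((hker x (F.syz_le i j hx)).1 hx)

theorem d_d (i : ℕ) (x : F.ι (i + 2) →₀ MvPolynomial (Fin n) K) : F.d i (F.d (i + 1) x) = 0 :=
  (F.exact_succ i).apply_apply_eq_zero x

variable {y : Fin n → MvPolynomial (Fin n) K} (θ : LinearCoordinates y)

include θ

theorem quotDim_syz_shift (i a : ℕ) (j : ℤ) :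
    quotDim (cyc y (F.syz i (j + 1)) (a + 2) Finset.univ)
        (bnd y (F.syz i j) (a + 2) Finset.univ) =
      quotDim (cyc y (F.syz (i + 1) (j + 2)) (a + 1) Finset.univ)
        (bnd y (F.syz (i + 1) (j + 1)) (a + 1) Finset.univ) := by
  have h2 : j + 2 = j + 1 + 1 := by ring
  rw [h2]
  exact quotDim_shift (F.d i) (fun s m hm => smul_mem_freePart (θ.isHomogeneous s) hm)
    (fun s m hm => smul_mem_freePart (θ.isHomogeneous s) hm) (F.map_d i j) (F.map_d i (j + 1)) a
    (cyc_freePart_eq_bnd θ j (a + 1)) (cyc_freePart_eq_bnd θ (j + 1) a)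

theorem quotDim_module_shift [IsGradedModule (n := n) 𝓜] (a : ℕ) (j : ℤ) :
    quotDim (cyc y (𝓜 (j + 1)) (a + 2) Finset.univ) (bnd y (𝓜 j) (a + 2) Finset.univ) =
      quotDim (cyc y (F.syz 0 (j + 2)) (a + 1) Finset.univ)
        (bnd y (F.syz 0 (j + 1)) (a + 1) Finset.univ) := by
  have h2 : j + 2 = j + 1 + 1 := by ring
  rw [h2]
  exact quotDim_shift F.aug (fun s m hm => smul_mem_freePart (θ.isHomogeneous s) hm)
    (fun s m hm => smul_mem_freePart (θ.isHomogeneous s) hm) (F.map_aug j) (F.map_aug (j + 1)) a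
    (cyc_freePart_eq_bnd θ j (a + 1)) (cyc_freePart_eq_bnd θ (j + 1) a)

omit θ in
theorem map_formSpan_d (i : ℕ) (j : ℤ) :
    (formSpan y (freePart (F.deg (i + 1)) j) Finset.univ).map ((F.d i).restrictScalars K) =
      formSpan y (F.syz i j) Finset.univ := by
  refine le_antisymm ?_ ?_
  · rw [Submodule.map_le_iff_le_comap]
    refine formSpan_le fun s hs m hm => ?_
    change F.d i (y s • m) ∈ formSpan y (F.syz i j) Finset.univ
    rw [map_smul]
    refine smul_mem_formSpan hs ?_
    rw [← map_d]
    exact Submodule.mem_map_of_mem hm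
  · refine formSpan_le fun s hs m hm => ?_
    rw [← map_d] at hm
    obtain ⟨x, hx, rfl⟩ := hm
    exact ⟨y s • x, smul_mem_formSpan hs hx, map_smul (F.d i) _ _⟩

/-- `Tor_{i+2}(K, M)` is the first Koszul homology of the syzygy module in `F_i`. -/
theorem torDim_eq_quotDim_syz (i : ℕ) (j : ℤ) :
    F.torDim (i + 2) (j + 2) =
      quotDim (cyc y (F.syz i (j + 1)) 1 Finset.univ) (bnd y (F.syz i j) 1 Finset.univ) := by
  have hsmul : ∀ (i : ℕ) (j : ℤ), ∀ s, ∀ m ∈ freePart (K := K) (F.deg i) j,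
      y s • m ∈ freePart (K := K) (F.deg i) (j + 1) :=
    fun i j s m hm => smul_mem_freePart (θ.isHomogeneous s) hm
  rw [← quotDim_preCyc_eq_image (F.d i) (hsmul (i + 1) j) (F.map_d i j) (F.map_d i (j + 1)),
    quotDim_preCyc_eq_kernel (F.d i) (hsmul (i + 1) (j + 1)) 0 (cyc_freePart_eq_bnd θ j 0)]
  have h2 : j + 2 = j + 1 + 1 := by ring
  rw [h2]
  -- Both sides are quotients of the space `P` of the elements of `F_{i+2}` that become cycles
  -- after tensoring with `K`.
  let one {m : ℕ} := (TensorProduct.mk (MvPolynomial (Fin n) K) (ResidueModule K n)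
    (F.ι m →₀ MvPolynomial (Fin n) K) (ResidueModule.one K n)).restrictScalars K
  let P : Submodule K (F.ι (i + 2) →₀ MvPolynomial (Fin n) K) :=
    freePart (F.deg (i + 2)) (j + 1 + 1) ⊓
      (formSpan y (freePart (F.deg (i + 1)) (j + 1)) Finset.univ).comap
        ((F.d (i + 1)).restrictScalars K)
  let Q : Submodule K (F.ι (i + 2) →₀ MvPolynomial (Fin n) K) :=
    (F.boundaries (i + 2) (j + 1 + 1)).comap one
  have hmem : ∀ x ∈ freePart (K := K) (F.deg (i + 2)) (j + 1 + 1),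
      one (F.d (i + 1) x) = 0 ↔ x ∈ P := fun x hx => by
    rw [Submodule.mem_inf, and_iff_right hx]
    exact one_tmul_eq_zero_iff θ (F.d_mem (i + 1) _ x hx)
  have hleft : quotDim P Q = F.torDim (i + 2) (j + 1 + 1) := by
    refine quotDim_eq_of_map one (le_antisymm ?_ ?_) fun x _ => Iff.rfl
    · rintro _ ⟨x, hx, rfl⟩
      exact ⟨Submodule.mem_map_of_mem hx.1, (hmem x hx.1).2 hx⟩
    · rintro _ ⟨⟨x, hx, rfl⟩, hx0⟩
      exact ⟨x, (hmem x hx).1 hx0, rfl⟩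
  rw [← hleft]
  change _ = quotDim (chains (F.syz (i + 1) (j + 1 + 1)) 0 Finset.univ ⊓ _)
    (bnd y (F.syz (i + 1) (j + 1)) 0 Finset.univ)
  refine quotDim_eq_of_map
    (LinearMap.single K (fun _ : Finset (Fin n) => F.ι (i + 1) →₀ MvPolynomial (Fin n) K) ∅ ∘ₗ
      (F.d (i + 1)).restrictScalars K) (le_antisymm ?_ ?_) ?_
  · rintro _ ⟨x, hx, rfl⟩
    refine ⟨single_mem_chains_zero.2 ?_, single_mem_bnd_zero.2 hx.2⟩
    rw [← map_d]
    exact Submodule.mem_map_of_mem hx.1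
  · rintro f ⟨hf, hfb⟩
    have hw := hf.1 ∅
    rw [eq_single_of_mem_chains_zero hf] at hfb ⊢
    rw [← map_d] at hw
    obtain ⟨x, hx, hxw⟩ := hw
    rw [← hxw] at hfb ⊢
    exact ⟨x, ⟨hx, single_mem_bnd_zero.1 hfb⟩, rfl⟩
  · intro x hx
    change LinearMap.single K (fun _ : Finset (Fin n) => F.ι (i + 1) →₀ MvPolynomial (Fin n) K) ∅
      (F.d (i + 1) x) ∈ _ ↔ one x ∈ F.boundaries (i + 2) (j + 1 + 1)
    rw [single_mem_bnd_zero, ← map_formSpan_d]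
    constructor
    · rintro ⟨u, hu, hux⟩
      have hux : F.d (i + 1) u = F.d (i + 1) x := hux
      have huA : u ∈ freePart (K := K) (F.deg (i + 2)) (j + 1 + 1) :=
        formSpan_le (fun s _ m hm => hsmul (i + 2) (j + 1) s m hm) hu
      have hz : x - u ∈ F.syz (i + 2) (j + 1 + 1) := by
        refine ⟨sub_mem hx.1 huA, ?_⟩
        change F.d (i + 1) (x - u) = 0
        rw [map_sub, hux, sub_self]
      rw [← map_d] at hz
      obtain ⟨z, hz, hzx⟩ := hz
      have hzx : F.d (i + 2) z = x - u := hzx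
      refine ⟨one z, Submodule.mem_map_of_mem hz, ?_⟩
      have hu0 : one u = 0 := (one_tmul_eq_zero_iff θ huA).2 hu
      change one (F.d (i + 2) z) = one x
      rw [hzx, map_sub, hu0, sub_zero]
    · rintro ⟨_, ⟨z, hz, rfl⟩, hzx⟩
      have hzx : one (F.d (i + 2) z) = one x := hzx
      have h0 : one (x - F.d (i + 2) z) = 0 := by rw [map_sub, hzx, sub_self]
      refine ⟨x - F.d (i + 2) z, (one_tmul_eq_zero_iff θ
        (sub_mem hx.1 (F.d_mem (i + 2) _ z hz))).1 h0, ?_⟩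
      change F.d (i + 1) (x - F.d (i + 2) z) = F.d (i + 1) x
      rw [map_sub, F.d_d (i + 1), sub_zero]

theorem torDim_eq_quotDim_syz_add (i a : ℕ) (j : ℤ) :
    F.torDim (i + a + 2) (j + a + 2) =
      quotDim (cyc y (F.syz i (j + 1)) (a + 1) Finset.univ)
        (bnd y (F.syz i j) (a + 1) Finset.univ) := by
  induction a generalizing i j with
  | zero => simpa using F.torDim_eq_quotDim_syz θ i j
  | succ a ih =>
    have h1 : i + (a + 1) + 2 = i + 1 + a + 2 := by ring
    have h2 : j + ((a + 1 : ℕ) : ℤ) + 2 = j + 1 + a + 2 := by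
      push_cast
      ring
    have h3 : j + 1 + 1 = j + 2 := by ring
    rw [h1, h2, ih (i + 1) (j + 1), F.quotDim_syz_shift θ i a j, h3]

/-- `Tor_a(K, M)` is the Koszul homology of `M`, in homological degrees `a > 1`. -/
theorem torDim_eq_quotDim [IsGradedModule (n := n) 𝓜] (a : ℕ) (j : ℤ) :
    F.torDim (a + 2) (j + a + 3) =
      quotDim (cyc y (𝓜 (j + 1)) (a + 2) Finset.univ) (bnd y (𝓜 j) (a + 2) Finset.univ) := by
  have h1 : a + 2 = 0 + a + 2 := by ring
  have h2 : j + a + 3 = j + 1 + a + 2 := by ring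
  have h3 : j + 1 + 1 = j + 2 := by ring
  rw [F.quotDim_module_shift θ a j, h2, h1, F.torDim_eq_quotDim_syz_add θ 0 a (j + 1), h3]

end GradedFreeResolution

end Tor

/-! ### Finite-dimensionality of the homogeneous parts -/

section Finiteness

open MvPolynomial

variable {K : Type*} [Field K] {n : ℕ}

theorem finiteDimensional_freePart {ι : Type*} [Finite ι] (deg : ι → ℤ) (j : ℤ) :
    FiniteDimensional K (freePart (K := K) (n := n) deg j) := by
  let B : Set (ι →₀ MvPolynomial (Fin n) K) := ⋃ e : ι,
    (fun c => Finsupp.single e (monomial c 1)) '' {c : Fin n →₀ ℕ | (c.degree : ℤ) + deg e = j}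
  have hB : B.Finite := by
    refine Set.finite_iUnion fun e => Set.Finite.image _ ?_
    refine (Finsupp.finite_of_degree_le (j - deg e).toNat).subset fun c hc => ?_
    have hc : (c.degree : ℤ) + deg e = j := hc
    change c.degree ≤ _
    omega
  have := FiniteDimensional.span_of_finite K hB
  refine Submodule.finiteDimensional_of_le (S₂ := Submodule.span K B) fun f hf => ?_
  rw [← Finsupp.sum_single f]
  refine Submodule.sum_mem _ fun e _ => ?_
  rw [MvPolynomial.as_sum (f e), ← Finsupp.singleAddHom_apply, map_sum]
  refine Submodule.sum_mem _ fun c hc => ?_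
  have h1 : (Finsupp.singleAddHom e) (monomial c (coeff c (f e))) =
      coeff c (f e) • Finsupp.single e (monomial c (1 : K)) := by
    rw [Finsupp.singleAddHom_apply, Finsupp.smul_single, smul_monomial, smul_eq_mul, mul_one]
  rw [h1]
  exact Submodule.smul_mem _ _ (Submodule.subset_span
    (Set.mem_iUnion.2 ⟨e, c, hf e c (mem_support_iff.1 hc), rfl⟩))

variable {M : Type*} [AddCommGroup M] [Module K M] [Module (MvPolynomial (Fin n) K) M]
  [IsScalarTower K (MvPolynomial (Fin n) K) M]

/-- The homogeneous parts of a finitely generated graded module are finite-dimensional. -/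
theorem finiteDimensional_graded_part [Module.Finite (MvPolynomial (Fin n) K) M]
    (𝓜 : ℤ → Submodule K M) [IsGradedModule (n := n) 𝓜] (j : ℤ) : FiniteDimensional K (𝓜 j) := by
  have hint := IsGradedModule.isInternal (n := n) (𝓜 := 𝓜)
  obtain ⟨G, hG⟩ := Module.Finite.fg_top (R := MvPolynomial (Fin n) K) (M := M)
  have hdec : ∀ x : M, ∃ f : ℤ →₀ M, (∀ j, f j ∈ 𝓜 j) ∧ (f.sum fun _ y => y) = x := fun x => by
    have hx : x ∈ ⨆ j, 𝓜 j := by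
      rw [hint.submodule_iSup_eq_top]
      trivial
    rwa [Submodule.mem_iSup_iff_exists_finsupp] at hx
  choose f hf hfs using hdec
  let E := Σ g : G, ((f g).support : Finset ℤ)
  let φ : (E →₀ MvPolynomial (Fin n) K) →ₗ[MvPolynomial (Fin n) K] M :=
    Finsupp.linearCombination _ fun e : E => f e.1 e.2
  have hφ : ∀ j, ∀ x ∈ freePart (fun e : E => (e.2 : ℤ)) j, φ x ∈ 𝓜 j := by
    intro j x hx
    change Finsupp.linearCombination _ _ x ∈ _
    rw [Finsupp.linearCombination_apply, Finsupp.sum]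
    refine Submodule.sum_mem _ fun e _ => ?_
    rw [MvPolynomial.as_sum (x e), Finset.sum_smul]
    refine Submodule.sum_mem _ fun c hc => ?_
    have h := IsGradedModule.smul_mem (n := n) (𝓜 := 𝓜) c.degree (e.2 : ℤ)
      (monomial c (coeff c (x e))) _ (isHomogeneous_monomial _ rfl) (hf e.1 e.2)
    rwa [add_comm, hx e c (mem_support_iff.1 hc)] at h
  have hsurj : LinearMap.range φ = ⊤ := by
    rw [eq_top_iff, ← hG, Submodule.span_le]
    intro g hg
    rw [← hfs g]
    refine Submodule.sum_mem _ fun i hi => ?_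
    exact ⟨Finsupp.single ⟨⟨g, hg⟩, ⟨i, hi⟩⟩ 1, by simp [φ]⟩
  have hmap : (freePart (fun e : E => (e.2 : ℤ)) j).map (φ.restrictScalars K) = 𝓜 j := by
    refine le_antisymm ?_ fun x hx => ?_
    · rintro _ ⟨x, hx, rfl⟩
      exact hφ j x hx
    · exact exists_homogeneous_lift hint.submodule_iSupIndep φ hφ hx (hsurj ▸ trivial)
  have := finiteDimensional_freePart (K := K) (n := n) (fun e : E => (e.2 : ℤ)) j
  rw [← hmap]
  infer_instance

end Finiteness

/-! ### Generic ranks -/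

section GenericRank

open MvPolynomial

variable {K V W Q : Type*} [Field K] [AddCommGroup V] [Module K V] [FiniteDimensional K V]
  [AddCommGroup W] [Module K W] [Fintype Q]

/-- The rank of a linear map depending linearly on parameters is constant on a nonempty Zariski
open set: it is maximal where a suitable minor does not vanish. -/
theorem exists_generic_rank (Φ : Q → V →ₗ[K] W) : ∃ (F : MvPolynomial Q K) (r : ℕ), F ≠ 0 ∧
    ∀ c : Q → K, eval c F ≠ 0 →
      Module.finrank K (LinearMap.range (∑ q, c q • Φ q)) = r := by
  classical
  obtain ⟨c₀, hc₀⟩ : ∃ c₀ : Q → K, ∀ c : Q → K,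
      Module.finrank K (LinearMap.range (∑ q, c q • Φ q)) ≤
        Module.finrank K (LinearMap.range (∑ q, c₀ q • Φ q)) := by
    have hfin : (Set.range fun c : Q → K =>
        Module.finrank K (LinearMap.range (∑ q, c q • Φ q))).Finite := by
      refine (Set.finite_Iic (Module.finrank K V)).subset ?_
      rintro _ ⟨c, rfl⟩
      exact LinearMap.finrank_range_le _
    obtain ⟨_, ⟨c₀, rfl⟩, h⟩ := Set.exists_max_image _ id hfin (Set.range_nonempty _)
    exact ⟨c₀, fun c => h _ ⟨c, rfl⟩⟩
  set Φ₀ := ∑ q, c₀ q • Φ q with hΦ₀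
  set r := Module.finrank K (LinearMap.range Φ₀) with hr
  let b : Module.Basis (Fin r) K (LinearMap.range Φ₀) := Module.finBasis K _
  have hu : ∀ i, ∃ u : V, Φ₀ u = b i := fun i => (b i).2
  choose u hu using hu
  obtain ⟨π, hπ⟩ := (LinearMap.range Φ₀).subtype.exists_leftInverse_of_injective
    (Submodule.ker_subtype _)
  -- `coord` gives the coordinates of a projection to the range of `Φ₀`.
  let coord : W →ₗ[K] (Fin r → K) := b.equivFun.toLinearMap ∘ₗ π
  let F : MvPolynomial Q K :=
    (Matrix.of fun i j => ∑ q, X q * C (coord (Φ q (u j)) i) :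
      Matrix (Fin r) (Fin r) (MvPolynomial Q K)).det
  have hF : ∀ c : Q → K, eval c F =
      (Matrix.of fun i j => coord ((∑ q, c q • Φ q) (u j)) i : Matrix (Fin r) (Fin r) K).det := by
    intro c
    rw [RingHom.map_det]
    congr 1
    ext i j
    simp [LinearMap.sum_apply]
  refine ⟨F, r, fun h0 => ?_, fun c hc => le_antisymm (hc₀ c) ?_⟩
  · have h1 := hF c₀
    rw [h0, map_zero] at h1
    have h2 : (Matrix.of fun i j => coord ((∑ q, c₀ q • Φ q) (u j)) i :
        Matrix (Fin r) (Fin r) K) = 1 := by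
      ext i j
      have h3 : π (b j) = b j := LinearMap.congr_fun hπ (b j)
      rw [Matrix.of_apply, ← hΦ₀, hu]
      change b.equivFun (π (b j)) i = _
      rw [h3, Module.Basis.equivFun_apply, Module.Basis.repr_self, Matrix.one_apply,
        Finsupp.single_apply]
      simp only [eq_comm]
    rw [h2, Matrix.det_one] at h1
    exact zero_ne_one h1
  · rw [hF] at hc
    have hli := Matrix.linearIndependent_cols_of_det_ne_zero hc
    have hli' : LinearIndependent K fun j => (∑ q, c q • Φ q) (u j) :=
      LinearIndependent.of_comp coord hli
    have hcard := finrank_span_eq_card hli'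
    rw [Fintype.card_fin] at hcard
    rw [← hcard]
    refine Submodule.finrank_mono ?_
    rw [Submodule.span_le]
    rintro _ ⟨j, rfl⟩
    exact ⟨u j, rfl⟩

end GenericRank

/-! ### Generic annihilator numbers -/

section GenericAnnihilator

set_option linter.unusedSectionVars false

open MvPolynomial

variable {K : Type*} [Field K] {n : ℕ} {M : Type*} [AddCommGroup M]
  [Module K M] [Module (MvPolynomial (Fin n) K) M] [IsScalarTower K (MvPolynomial (Fin n) K) M]

theorem exists_generic_finrank_formSpan (A : Submodule K M) [FiniteDimensional K A]
    (W : Finset (Fin n)) : ∃ (F : MvPolynomial (Fin n × Fin n) K) (r : ℕ), F ≠ 0 ∧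
      ∀ c : Fin n × Fin n → K, eval c F ≠ 0 →
        Module.finrank K (formSpan (linearForm c) A W) = r := by
  classical
  let Φ : Fin n × Fin n → (Fin n → A) →ₗ[K] M := fun q => if q.1 ∈ W then
    (LinearMap.lsmul (MvPolynomial (Fin n) K) M (X q.2)).restrictScalars K ∘ₗ A.subtype ∘ₗ
      LinearMap.proj q.1 else 0
  obtain ⟨F, r, hF, h⟩ := exists_generic_rank Φ
  refine ⟨F, r, hF, fun c hc => ?_⟩
  rw [← h c hc]
  have hΦ : ∀ m : Fin n → A, (∑ q, c q • Φ q) m = ∑ s ∈ W, linearForm c s • (m s : M) := by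
    intro m
    have hs : ∀ s, ∑ l, (c (s, l) • Φ (s, l)) m =
        if s ∈ W then linearForm c s • (m s : M) else 0 := fun s => by
      by_cases hsW : s ∈ W
      · rw [if_pos hsW, linearForm, Finset.sum_smul]
        refine Finset.sum_congr rfl fun l _ => ?_
        have hΦs : Φ (s, l) m = (X l : MvPolynomial (Fin n) K) • (m s : M) := by
          simp only [Φ, if_pos hsW]
          rfl
        rw [LinearMap.smul_apply, hΦs, smul_assoc]
      · rw [if_neg hsW]
        refine Finset.sum_eq_zero fun l _ => ?_
        simp only [Φ, if_neg hsW, smul_zero, LinearMap.zero_apply]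
    rw [LinearMap.sum_apply, Fintype.sum_prod_type, Finset.sum_congr rfl fun s _ => hs s,
      Finset.sum_ite_mem, Finset.univ_inter]
  have hrange : LinearMap.range (∑ q, c q • Φ q) = formSpan (linearForm c) A W := by
    refine le_antisymm ?_ ?_
    · rintro _ ⟨m, rfl⟩
      rw [hΦ]
      exact Submodule.sum_mem _ fun s hs => smul_mem_formSpan hs (m s).2
    · refine formSpan_le fun s hs m hm => ⟨Pi.single s ⟨m, hm⟩, ?_⟩
      rw [hΦ, Finset.sum_eq_single_of_mem s hs]
      · rw [Pi.single_eq_same]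
      · intro t _ hts
        rw [Pi.single_eq_of_ne hts]
        simp
  rw [hrange]

variable (𝓜 : ℤ → Submodule K M) [IsGradedModule (n := n) 𝓜]

theorem form_smul_mem {f : MvPolynomial (Fin n) K} (hf : f.IsHomogeneous 1) {j : ℤ} {m : M}
    (hm : m ∈ 𝓜 j) : f • m ∈ 𝓜 (j + 1) := by
  have h := IsGradedModule.smul_mem (n := n) (𝓜 := 𝓜) 1 j f m hf hm
  exact_mod_cast h

theorem precedingSubmodule_inf (c : Fin n × Fin n → K) (p : Fin n) (j : ℤ) :
    𝓜 (j + 1) ⊓ (precedingSubmodule M c p).restrictScalars K =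
      formSpan (linearForm c) (𝓜 j) (Finset.univ.filter (· < p)) := by
  have hint := IsGradedModule.isInternal (n := n) (𝓜 := 𝓜)
  let 𝓖 : ℤ → Submodule K M := fun j =>
    formSpan (linearForm c) (𝓜 (j - 1)) (Finset.univ.filter (· < p))
  refine le_antisymm ?_ ?_
  · rintro x ⟨hx, hxN⟩
    have hxN : x ∈ precedingSubmodule M c p := hxN
    have h𝓖 : ∀ i, 𝓖 i ≤ 𝓜 i := fun i => formSpan_le fun s _ m hm => by
      have h := form_smul_mem (n := n) 𝓜 (isHomogeneous_linearForm c s) hm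
      rwa [sub_add_cancel] at h
    have hgen : ∀ q < p, ∀ m : M, linearForm c q • m ∈ ⨆ i, 𝓖 i := by
      intro q hq m
      have hle : (⊤ : Submodule K M) ≤ (⨆ i, 𝓖 i).comap
          ((LinearMap.lsmul (MvPolynomial (Fin n) K) M (linearForm c q)).restrictScalars K) := by
        rw [← hint.submodule_iSup_eq_top]
        refine iSup_le fun i m hm => Submodule.mem_iSup_of_mem (i + 1) ?_
        refine smul_mem_formSpan (by simpa using hq) ?_
        rwa [add_sub_cancel_right]
      exact hle (Submodule.mem_top (x := m))
    have hN : x ∈ ⨆ i, 𝓖 i := by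
      refine Submodule.smul_induction_on hxN (fun f hf m _ => ?_) fun a b ha hb => add_mem ha hb
      induction hf using Submodule.span_induction generalizing m with
      | mem f hf =>
        obtain ⟨q, hq, rfl⟩ := hf
        exact hgen q hq m
      | zero => rw [zero_smul]; exact zero_mem _
      | add f g _ _ hf hg => rw [add_smul]; exact add_mem (hf m trivial) (hg m trivial)
      | smul a f _ hf => rw [smul_eq_mul, mul_comm, mul_smul]; exact hf _ trivial
    have h := mem_of_mem_iSup_of_le hint.submodule_iSupIndep h𝓖 hx hN
    simpa [𝓖] using h
  · refine formSpan_le fun s hs m hm => ⟨form_smul_mem 𝓜 (isHomogeneous_linearForm c s) hm, ?_⟩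
    have hsp : s < p := by simpa using hs
    have hf : linearForm c s ∈ Ideal.span (linearForm c '' {q | q < p}) :=
      Ideal.subset_span (Set.mem_image_of_mem _ hsp)
    have h : linearForm c s • m ∈ precedingSubmodule M c p :=
      Submodule.smul_mem_smul hf Submodule.mem_top
    exact h

variable [Module.Finite (MvPolynomial (Fin n) K) M]

/-- The homogeneous elements that `y_{p+1}` multiplies into `(y_1, …, y_p) M`, counted modulo
`(y_1, …, y_p) M`. -/
theorem annihilatorDim_add_finrank (c : Fin n × Fin n → K) (p : Fin n) (j : ℤ) :
    annihilatorDim 𝓜 c p (j + 1) +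
        Module.finrank K (formSpan (linearForm c) (𝓜 j) (Finset.univ.filter (· < p))) =
      Module.finrank K ↥(𝓜 (j + 1) ⊓
        (formSpan (linearForm c) (𝓜 (j + 1)) (Finset.univ.filter (· < p))).comap
          ((LinearMap.lsmul (MvPolynomial (Fin n) K) M (linearForm c p)).restrictScalars K)) := by
  have := finiteDimensional_graded_part (n := n) 𝓜 (j + 1)
  rw [← precedingSubmodule_inf 𝓜 c p j, ← precedingSubmodule_inf 𝓜 c p (j + 1)]
  set P : Submodule K M := 𝓜 (j + 1) ⊓ (𝓜 (j + 1 + 1) ⊓ (precedingSubmodule M c p).restrictScalars K).comap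
    ((LinearMap.lsmul (MvPolynomial (Fin n) K) M (linearForm c p)).restrictScalars K) with hP
  have hfd : FiniteDimensional K P :=
    Submodule.finiteDimensional_of_le (inf_le_left : P ≤ 𝓜 (j + 1))
  rw [finrank_eq_map_add_inf_ker P ((precedingSubmodule M c p).mkQ.restrictScalars K)]
  have hmemP : ∀ m ∈ 𝓜 (j + 1), m ∈ P ↔ linearForm c p • m ∈ precedingSubmodule M c p := fun m hm =>
    ⟨fun h => h.2.2, fun h => ⟨hm, form_smul_mem 𝓜 (isHomogeneous_linearForm c p) hm, h⟩⟩
  have hker : P ⊓ LinearMap.ker ((precedingSubmodule M c p).mkQ.restrictScalars K) =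
      𝓜 (j + 1) ⊓ (precedingSubmodule M c p).restrictScalars K := by
    ext m
    have hk : m ∈ LinearMap.ker ((precedingSubmodule M c p).mkQ.restrictScalars K) ↔ m ∈ precedingSubmodule M c p :=
      Submodule.Quotient.mk_eq_zero (precedingSubmodule M c p)
    rw [Submodule.mem_inf, Submodule.mem_inf, hk]
    constructor
    · exact fun h => ⟨h.1.1, h.2⟩
    · exact fun h => ⟨(hmemP m h.1).2 ((precedingSubmodule M c p).smul_mem _ h.2), h.2⟩
  rw [hker]
  congr 1
  rw [annihilatorDim]
  have hmap : (annihilatorModule M c p).restrictScalars K ⊓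
      (𝓜 (j + 1)).map ((precedingSubmodule M c p).mkQ.restrictScalars K) = P.map ((precedingSubmodule M c p).mkQ.restrictScalars K) := by
    refine le_antisymm ?_ ?_
    · rintro _ ⟨⟨m', hm', hmm⟩, ⟨m, hm, rfl⟩⟩
      refine ⟨m, (hmemP m hm).2 ?_, rfl⟩
      have hm' : linearForm c p • m' ∈ precedingSubmodule M c p := hm'
      have hmm : (precedingSubmodule M c p).mkQ m' = (precedingSubmodule M c p).mkQ m := hmm
      have hsub : m - m' ∈ precedingSubmodule M c p := by
        rw [← Submodule.Quotient.mk_eq_zero (precedingSubmodule M c p), Submodule.Quotient.mk_sub, sub_eq_zero]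
        exact hmm.symm
      have h := add_mem ((precedingSubmodule M c p).smul_mem (linearForm c p) hsub) hm'
      rwa [← smul_add, sub_add_cancel] at h
    · rintro _ ⟨m, hm, rfl⟩
      exact ⟨⟨m, (hmemP m hm.1).1 hm, rfl⟩, ⟨m, hm.1, rfl⟩⟩
  rw [hmap]

theorem finrank_comap_formSpan {y : Fin n → MvPolynomial (Fin n) K} (A : Submodule K M)
    [FiniteDimensional K A] {W : Finset (Fin n)} {r : Fin n} :
    Module.finrank K ↥(A ⊓ (formSpan y A W).comap
        ((LinearMap.lsmul (MvPolynomial (Fin n) K) M (y r)).restrictScalars K)) +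
      Module.finrank K (formSpan y A (insert r W)) =
    Module.finrank K A + Module.finrank K (formSpan y A W) := by
  have hfd : ∀ V : Finset (Fin n), FiniteDimensional K (formSpan y A V) := fun V => by
    rw [formSpan]
    infer_instance
  have hle : formSpan y A W ≤ formSpan y A (insert r W) :=
    formSpan_le fun s hs m hm => smul_mem_formSpan (Finset.mem_insert_of_mem hs) hm
  have h1 := finrank_eq_map_add_inf_ker A ((formSpan y A W).mkQ ∘ₗ
    (LinearMap.lsmul (MvPolynomial (Fin n) K) M (y r)).restrictScalars K)
  have h2 := finrank_eq_map_add_inf_ker (formSpan y A (insert r W)) (formSpan y A W).mkQ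
  rw [LinearMap.ker_comp, Submodule.ker_mkQ] at h1
  rw [Submodule.ker_mkQ, inf_eq_right.2 hle] at h2
  have h3 : (formSpan y A (insert r W)).map (formSpan y A W).mkQ =
      A.map ((formSpan y A W).mkQ ∘ₗ
        (LinearMap.lsmul (MvPolynomial (Fin n) K) M (y r)).restrictScalars K) := by
    have hins : formSpan y A (insert r W) = A.map
        ((LinearMap.lsmul (MvPolynomial (Fin n) K) M (y r)).restrictScalars K) ⊔
          formSpan y A W := by
      rw [formSpan, Finset.iSup_insert]
      rfl
    rw [hins, Submodule.map_sup, Submodule.map_comp, Submodule.mkQ_map_self, sup_bot_eq]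
  rw [h3] at h2
  omega

/-- The dimension of the annihilator is a combination of ranks of linear maps depending linearly
on the coefficients, so it has a generic value. -/
theorem exists_isGenericAnnihilatorDim (p : Fin n) (k : ℤ) :
    ∃ a, IsGenericAnnihilatorDim 𝓜 p k a := by
  obtain ⟨j, rfl⟩ : ∃ j, k = j + 1 := ⟨k - 1, by ring⟩
  have h0 := finiteDimensional_graded_part (n := n) 𝓜 j
  have h1 := finiteDimensional_graded_part (n := n) 𝓜 (j + 1)
  obtain ⟨F₁, r₁, hF₁, h₁⟩ :=
    exists_generic_finrank_formSpan (𝓜 j) (Finset.univ.filter (· < p))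
  obtain ⟨F₂, r₂, hF₂, h₂⟩ :=
    exists_generic_finrank_formSpan (𝓜 (j + 1)) (Finset.univ.filter (· < p))
  obtain ⟨F₃, r₃, hF₃, h₃⟩ :=
    exists_generic_finrank_formSpan (𝓜 (j + 1)) (insert p (Finset.univ.filter (· < p)))
  refine ⟨Module.finrank K (𝓜 (j + 1)) + r₂ - r₃ - r₁, F₁ * F₂ * F₃,
    mul_ne_zero (mul_ne_zero hF₁ hF₂) hF₃, fun c hc => ?_⟩
  rw [map_mul, map_mul] at hc
  have e1 := h₁ c (left_ne_zero_of_mul (left_ne_zero_of_mul hc))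
  have e2 := h₂ c (right_ne_zero_of_mul (left_ne_zero_of_mul hc))
  have e3 := h₃ c (right_ne_zero_of_mul hc)
  have e4 := annihilatorDim_add_finrank 𝓜 c p j
  have e5 := finrank_comap_formSpan (y := linearForm c) (𝓜 (j + 1))
    (W := Finset.univ.filter (· < p)) (r := p)
  omega

omit [IsGradedModule (n := n) 𝓜] [Module.Finite (MvPolynomial (Fin n) K) M] in
theorem exists_eval_ne_zero [Infinite K] {σ : Type*} {F : MvPolynomial σ K} (hF : F ≠ 0) :
    ∃ c, eval c F ≠ 0 := by
  by_contra! h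
  exact hF (MvPolynomial.funext fun c => by rw [h c, map_zero])

theorem isGenericAnnihilatorDim_genericAnnihilatorNumber [Infinite K] (p : Fin n) (k : ℤ) :
    IsGenericAnnihilatorDim 𝓜 p k (genericAnnihilatorNumber n 𝓜 p k) := by
  obtain ⟨a, ha⟩ := exists_isGenericAnnihilatorDim 𝓜 p k
  have h : {a | IsGenericAnnihilatorDim 𝓜 p k a} = {a} := by
    refine Set.eq_singleton_iff_unique_mem.2 ⟨ha, ?_⟩
    -- Two nonempty Zariski open sets meet.
    rintro b ⟨F, hF, hb⟩
    obtain ⟨G, hG, ha⟩ := ha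
    obtain ⟨c, hc⟩ := exists_eval_ne_zero (mul_ne_zero hF hG)
    rw [map_mul] at hc
    rw [← hb c (left_ne_zero_of_mul hc), ← ha c (right_ne_zero_of_mul hc)]
  rw [genericAnnihilatorNumber, h, csSup_singleton]
  exact ha

/-- There are coordinates for which the annihilator dimensions take their generic values in
every order of the linear forms. -/
theorem exists_generic_coordinates [Infinite K] (k : ℤ) : ∃ c : Fin n × Fin n → K,
    (Matrix.of fun p l => c (p, l)).det ≠ 0 ∧
    ∀ (σ : Equiv.Perm (Fin n)) (p : Fin n),
      annihilatorDim 𝓜 (fun q => c (σ q.1, q.2)) p k = genericAnnihilatorNumber n 𝓜 p k := by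
  choose F hF h using fun p => isGenericAnnihilatorDim_genericAnnihilatorNumber (n := n) 𝓜 p k
  let f : Equiv.Perm (Fin n) → Fin n × Fin n → Fin n × Fin n := fun σ q => (σ q.1, q.2)
  have hf : ∀ σ, Function.Injective (f σ) := fun σ => by
    rintro ⟨a, b⟩ ⟨a', b'⟩ h
    simpa [f] using h
  have hne : (Matrix.mvPolynomialX (Fin n) (Fin n) K).det *
      ∏ σ : Equiv.Perm (Fin n), ∏ p, rename (f σ) (F p) ≠ 0 := by
    refine mul_ne_zero (Matrix.det_mvPolynomialX_ne_zero _ _)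
      (Finset.prod_ne_zero_iff.2 fun σ _ => Finset.prod_ne_zero_iff.2 fun p _ h0 => hF p ?_)
    exact rename_injective (f σ) (hf σ) (h0.trans (map_zero _).symm)
  obtain ⟨c, hc⟩ := exists_eval_ne_zero hne
  rw [map_mul, RingHom.map_det] at hc
  refine ⟨c, ?_, fun σ p => ?_⟩
  · have h1 : (eval c).mapMatrix (Matrix.mvPolynomialX (Fin n) (Fin n) K) =
        Matrix.of fun p l => c (p, l) := by
      ext p l
      simp [Matrix.mvPolynomialX]
    rw [← h1]
    exact left_ne_zero_of_mul hc
  · have h1 := right_ne_zero_of_mul hc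
    rw [map_prod, Finset.prod_ne_zero_iff] at h1
    have h2 := h1 σ (Finset.mem_univ σ)
    rw [map_prod, Finset.prod_ne_zero_iff] at h2
    have h3 := h2 p (Finset.mem_univ p)
    rw [eval_rename] at h3
    exact h p _ h3

end GenericAnnihilator

/-! ### Reordering the linear forms -/

section Orders

/-- Every set `W` and index `r ∉ W` are the first `|W|` indices and the next one in a suitable
order. -/
theorem exists_perm_image_filter_lt {n : ℕ} (W : Finset (Fin n)) (r : Fin n) (hr : r ∉ W)
    (h : W.card < n) : ∃ σ : Equiv.Perm (Fin n),
      (Finset.univ.filter (· < (⟨W.card, h⟩ : Fin n))).image σ = W ∧ σ ⟨W.card, h⟩ = r := by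
  set p : Fin n := ⟨W.card, h⟩ with hp
  have hlt : (Finset.univ.filter (· < p)).card = W.card := by
    have h0 : Finset.univ.filter (· < p) = Finset.Iio p := by
      ext q
      simp
    rw [h0, Fin.card_Iio]
  have hcard : Fintype.card {q // q < p} = Fintype.card {q // q ∈ W} := by
    rw [Fintype.card_subtype, Fintype.card_coe, hlt]
  let e : {q // q < p} ≃ {q // q ∈ W} := Fintype.equivOfCardEq hcard
  let τ : Equiv.Perm (Fin n) := e.extendSubtype
  have hτ : ∀ q, q < p → τ q ∈ W := fun q hq => e.extendSubtype_mem q hq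
  have hτp : τ p ∉ W := e.extendSubtype_not_mem p (lt_irrefl p)
  refine ⟨τ.trans (Equiv.swap (τ p) r), ?_, by simp⟩
  refine Finset.eq_of_subset_of_card_le ?_ ?_
  · intro x hx
    obtain ⟨q, hq, rfl⟩ := Finset.mem_image.1 hx
    have hq' := hτ q (by simpa using hq)
    rw [Equiv.trans_apply, Equiv.swap_apply_of_ne_of_ne]
    · exact hq'
    · rintro h0
      exact hτp (h0 ▸ hq')
    · rintro h0
      exact hr (h0 ▸ hq')
  · rw [Finset.card_image_of_injective _ (Equiv.injective _), hlt]

end Orders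

/-! ### Rigidity of graded Betti numbers -/

section Rigidity

open MvPolynomial

universe u v

variable {K : Type u} [Field K] {n : ℕ} {M : Type v} [AddCommGroup M]
  [Module K M] [Module (MvPolynomial (Fin n) K) M] [IsScalarTower K (MvPolynomial (Fin n) K) M]

theorem formSpan_comp (y : Fin n → MvPolynomial (Fin n) K) (σ : Equiv.Perm (Fin n))
    (A : Submodule K M) (W : Finset (Fin n)) :
    formSpan (fun s => y (σ s)) A W = formSpan y A (W.image σ) := by
  rw [formSpan, formSpan, Finset.iSup_finset_image]

/-- The generic annihilator numbers of `M` in degree `k`, indexed from `0` and extended by zero. -/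
def annihilatorNumbers (n : ℕ) {M : Type v} [AddCommGroup M] [Module K M]
    [Module (MvPolynomial (Fin n) K) M] [IsScalarTower K (MvPolynomial (Fin n) K) M]
    (𝓜 : ℤ → Submodule K M) (k : ℤ) (j : ℕ) : ℕ :=
  if h : j < n then genericAnnihilatorNumber n 𝓜 ⟨j, h⟩ k else 0

/-- The condition on the summation index in `bettiBound` only discards vanishing binomial
coefficients. -/
theorem bettiBound_eq_annihilatorSum (𝓜 : ℤ → Submodule K M) (a : ℕ) (k : ℤ) :
    bettiBound n 𝓜 (a + 1) k = annihilatorSum (annihilatorNumbers n 𝓜 k) a n := by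
  rw [bettiBound, annihilatorSum, Finset.sum_range, Finset.sum_filter]
  refine Finset.sum_congr rfl fun p _ => ?_
  have h1 : annihilatorNumbers n 𝓜 k p = genericAnnihilatorNumber n 𝓜 p k := dif_pos p.2
  have h2 : n - 1 - (p : ℕ) = n - (p + 1) := by omega
  rw [h1, h2, Nat.add_sub_cancel]
  split_ifs with h
  · rfl
  · rw [Nat.choose_eq_zero_of_lt (by omega), zero_mul]

/-- As every order of the forms is generic, the annihilator dimension for `W` and `r` depends only on
the cardinality of `W`. -/
theorem finrank_killed_eq {𝓜 : ℤ → Submodule K M} [IsGradedModule (n := n) 𝓜]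
    [Module.Finite (MvPolynomial (Fin n) K) M] {c : Fin n × Fin n → K} {j : ℤ}
    (hc : ∀ (σ : Equiv.Perm (Fin n)) (p : Fin n), annihilatorDim 𝓜 (fun q => c (σ q.1, q.2)) p
      (j + 1) = genericAnnihilatorNumber n 𝓜 p (j + 1))
    (W : Finset (Fin n)) (r : Fin n) (hr : r ∉ W) :
    Module.finrank K (killed (linearForm c) (𝓜 (j + 1)) 0 W r) =
      annihilatorNumbers n 𝓜 (j + 1) W.card +
        Module.finrank K (bnd (linearForm c) (𝓜 j) 0 W) := by
  have hW : W.card < n := by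
    have h := Finset.card_lt_univ_of_notMem hr
    rwa [Fintype.card_fin] at h
  obtain ⟨σ, hσW, hσr⟩ := exists_perm_image_filter_lt W r hr hW
  have h := annihilatorDim_add_finrank 𝓜 (fun q => c (σ q.1, q.2)) ⟨W.card, hW⟩ j
  have hform : linearForm (fun q => c (σ q.1, q.2)) = fun s => linearForm c (σ s) := rfl
  rw [hc, hform, formSpan_comp, formSpan_comp, hσW] at h
  beta_reduce at h
  rw [hσr] at h
  rw [finrank_killed_zero, finrank_bnd_zero, ← h, annihilatorNumbers, dif_pos hW]

/-- Rigidity passes from one homological degree to the next. -/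
theorem gradedBetti_succ_eq_bettiBound [Infinite K] (𝓜 : ℤ → Submodule K M)
    [IsGradedModule (n := n) 𝓜] [Module.Finite (MvPolynomial (Fin n) K) M] (i : ℕ) (hi : 1 < i)
    (k : ℤ) (h : gradedBetti (n := n) 𝓜 i (i + k) = bettiBound n 𝓜 i k) :
    gradedBetti (n := n) 𝓜 (i + 1) ((i + 1 : ℕ) + k) = bettiBound n 𝓜 (i + 1) k := by
  obtain ⟨a, rfl⟩ : ∃ a, i = a + 2 := ⟨i - 2, by omega⟩
  obtain ⟨j, rfl⟩ : ∃ j, k = j + 1 := ⟨k - 1, by ring⟩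
  have := finiteDimensional_graded_part (n := n) 𝓜 j
  have := finiteDimensional_graded_part (n := n) 𝓜 (j + 1)
  obtain ⟨c, hdet, hc⟩ := exists_generic_coordinates (n := n) 𝓜 (j + 1)
  have hA : ∀ s, ∀ m ∈ 𝓜 j, linearForm c s • m ∈ 𝓜 (j + 1) := fun s m hm =>
    form_smul_mem 𝓜 (isHomogeneous_linearForm c s) hm
  have hTor : ∀ b : ℕ, gradedBetti (n := n) 𝓜 (b + 2) ((b + 2 : ℕ) + (j + 1)) =
      quotDim (cyc (linearForm c) (𝓜 (j + 1)) (b + 2) Finset.univ)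
        (bnd (linearForm c) (𝓜 j) (b + 2) Finset.univ) := fun b => by
    have hdeg : ((b + 2 : ℕ) : ℤ) + (j + 1) = j + b + 3 := by
      push_cast
      ring
    rw [hdeg]
    exact GradedFreeResolution.torDim_eq_quotDim _ (linearCoordinates c hdet) b j
  rw [hTor, bettiBound_eq_annihilatorSum] at h
  have h' := quotDim_univ_succ_eq hA (finrank_killed_eq hc) a (by rwa [Fintype.card_fin])
  rw [Fintype.card_fin] at h'
  rw [bettiBound_eq_annihilatorSum, ← h']
  exact hTor (a + 1)

end Rigidity

end GradedBetti

end

theorem theorem2p1 {K : Type*} [Field K] [Infinite K] (n : ℕ) {M : Type*} [AddCommGroup M]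
    [Module K M] [Module (MvPolynomial (Fin n) K) M] [IsScalarTower K (MvPolynomial (Fin n) K) M]
    [Module.Finite (MvPolynomial (Fin n) K) M]
    (𝓜 : ℤ → Submodule K M) [GradedBetti.IsGradedModule (n := n) 𝓜]
    (i : ℕ) (hi : 1 < i) (k : ℤ)
    (h : GradedBetti.gradedBetti (n := n) 𝓜 i (i + k) = GradedBetti.bettiBound n 𝓜 i k)
    (q : ℕ) (hq : i ≤ q) :
    GradedBetti.gradedBetti (n := n) 𝓜 q (q + k) = GradedBetti.bettiBound n 𝓜 q k := by
  induction q, hq using Nat.le_induction with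
  | base => exact h
  | succ q hq ih => exact GradedBetti.gradedBetti_succ_eq_bettiBound 𝓜 q (by omega) k ih
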